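/- Let $\Sigma=\{1,\dots,\sigma\}$ and let $w\in\Sigma^*$ be a word of length $n$, where $1\le\sigma\le n$; $w[j+1:i]$ denotes the factor of $w$ from position $j+1$ to position $i$. A word $v\in\Sigma^*$ is a \emph{minimal absent subsequence} (MAS) of $w$ if $v$ is not a (scattered) subsequence of $w$ but every proper subsequence of $v$ is. Let $\mathcal D_w$ be the directed graph with nodes $\{(i,j)\mid 0\le j<i\le n\}\cup\{(0,0),f\}$ and the following edges, labelled by letters of $\Sigma$: \begin{itemize} \item $(0,0)\to(i,0)$ with label $a$, if $i$ is the first position of $w$ at which $a$ occurs; \item $(i,j)\to(k,i)$ with label $a$, for $j<i$, if $a$ occurs in $w[j+1:i]$ and $k$ is the first position greater than $i$ at which $a$ occurs; \item $(i,j)\to f$ with label $b$, for $j<i$, if $b$ occurs in $w[j+1:i]$ but not in $w[i+1:n]$; \item $(0,0)\to f$ with label $a$, if $a\in\Sigma$ does not occur in $w$ (there is no such edge if all letters of $\Sigma$ occur in $w$). \end{itemize} Then $\mathcal D_w$ is acyclic, and reading the labels along a path is a bijection from the set of paths from $(0,0)$ to $f$ onto the set of all MAS of $w$. Moreover, on a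 unit-cost RAM with words of logarithmic size (at least $c\log n$ bits for a constant $c$), there are algorithms, independent of $w$ and $\sigma$, such that, given $w$ and $\sigma$, one can construct in $O(n^2\sigma)$ time data structures that contain $\mathcal D_w$, stored as an $(n+1)\times(n+1)\times\sigma$ table of edges, and with which the following tasks can be performed, any number of times: \begin{enumerate} \item check, in $O(m)$ time (meaning at most $C(m+1)$ steps), whether a given word $u\in\Sigma^*$ of length $m$ is an MAS of $w$; \item compute, in time polynomial in $n$, an MAS of $w$ of maximal length; \item decide, in time polynomial in $n$, whether $w$ has an MAS of a given length $\ell$; \item enumerate all MAS of $w$, each exactly once, with polynomial delay: the time before the first MAS is completed, between two consecutive ones, and from the last one to the end of the computation is polynomial in $n$. \end{enumerate} -/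

import Mathlib

namespace MASRep

/-! ### Minimal absent subsequences -/

/-- `v` is a minimal absent subsequence of `w`: it is not a subsequence of `w`, but each of its
proper subsequences is. -/
def IsMAS {σ : ℕ} (w v : List (Fin σ)) : Prop :=
  ¬ List.Sublist v w ∧ ∀ u : List (Fin σ), List.Sublist u v → u ≠ v → List.Sublist u w

/-! ### The labelled graph of a word -/

/-- The factor `w[j+1 : i]`, with positions counted from `1`. -/
def factor {σ : ℕ} (w : List (Fin σ)) (j i : ℕ) : List (Fin σ) := (w.take i).drop j

/-- `k` is the leftmost position of `w` (counted from `1`) that is larger than `i` and carries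
the letter `a`. -/
def IsNext {σ : ℕ} (w : List (Fin σ)) (i : ℕ) (a : Fin σ) (k : ℕ) : Prop :=
  i < k ∧ w[k - 1]? = some a ∧ ∀ l, i < l → l < k → w[l - 1]? ≠ some a

/-- Nodes: pairs of positions, and the sink. -/
inductive Node where
  | pos (i j : ℕ) : Node
  | sink : Node

/-- The pairs that are nodes of the graph of a word of length `n`. -/
def IsPair (n i j : ℕ) : Prop := (j < i ∧ i ≤ n) ∨ (i = 0 ∧ j = 0)

/-- `Edge w x a y`: the graph of `w` has an edge from `x` to `y` with label `a`. Edges of type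
`absent` are there only if some letter of the alphabet does not occur in `w`. -/
inductive Edge {σ : ℕ} (w : List (Fin σ)) : Node → Fin σ → Node → Prop
  | start (a : Fin σ) (i : ℕ) : IsNext w 0 a i → Edge w (.pos 0 0) a (.pos i 0)
  | step (i j : ℕ) (a : Fin σ) (k : ℕ) : j < i → a ∈ factor w j i → IsNext w i a k →
      Edge w (.pos i j) a (.pos k i)
  | final (i j : ℕ) (b : Fin σ) : j < i → i ≤ w.length → b ∈ factor w j i →
      b ∉ factor w i w.length → Edge w (.pos i j) b .sink
  | absent (a : Fin σ) : a ∉ w → Edge w (.pos 0 0) a .sink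

/-- A path from `x` to `y`, given as the list of the labels and end nodes of its edges. -/
def IsPath {σ : ℕ} (w : List (Fin σ)) : Node → List (Fin σ × Node) → Node → Prop
  | x, [], y => x = y
  | x, (a, z) :: p, y => Edge w x a z ∧ IsPath w z p y

/-- The word read along a path. -/
def label {σ : ℕ} (p : List (Fin σ × Node)) : List (Fin σ) := p.map Prod.fst

/-- There is no closed path of positive length. -/
def IsAcyclic {σ : ℕ} (w : List (Fin σ)) : Prop :=
  ∀ (x : Node) (p : List (Fin σ × Node)), IsPath w x p x → p = []

/-- The array `D` is a table of the graph of `w`, an `(n+1) × (n+1) × σ` array stored row by row: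
for a node `(i, j)` and a letter `a`, the entry `D[i][j][a]` is `k` if there is an edge with label
`a` from `(i, j)` to `(k, i)`, it is `n + 1` if there is one to the sink, and `0` otherwise. -/
def StoresGraph {σ : ℕ} (w : List (Fin σ)) (D : ℕ → ℕ) : Prop :=
  ∀ (i j : ℕ) (a : Fin σ), IsPair w.length i j →
    D ((i * (w.length + 1) + j) * σ + a) ≤ w.length + 1 ∧
    (∀ k, 1 ≤ k → k ≤ w.length →
      (D ((i * (w.length + 1) + j) * σ + a) = k ↔ Edge w (.pos i j) a (.pos k i))) ∧
    (D ((i * (w.length + 1) + j) * σ + a) = w.length + 1 ↔ Edge w (.pos i j) a .sink)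

/-! ### A unit-cost random access machine with bounded words

The machine has registers and arrays of words; a word is a natural number below a bound `W` (so it
has `log W` bits), and a computation in which a larger number would arise is stuck. Every operation
on words, every access to a register or an array cell with a computed index, every test, and every
output of a word takes one unit of time. Control flow is structured. A program mentions finitely
many registers and arrays, so that these could as well be interleaved in a single memory. -/

/-- Names of arrays. A program that answers queries has to keep the arrays `input` and `data`. -/
inductive Arr where
  | input : Arr
  | query : Arr
  | data (k : ℕ) : Arr
  | work (k : ℕ) : Arr
  deriving DecidableEq

inductive Op where
  | add | sub | mul | div | mod | lt | eq

/-- Subtraction is truncated at `0`, division rounds down, tests return `1` or `0`. -/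
def Op.apply : Op → ℕ → ℕ → ℕ
  | .add, x, y => x + y
  | .sub, x, y => x - y
  | .mul, x, y => x * y
  | .div, x, y => x / y
  | .mod, x, y => x % y
  | .lt, x, y => if x < y then 1 else 0
  | .eq, x, y => if x = y then 1 else 0

inductive Expr where
  | const (c : ℕ) : Expr
  | reg (x : ℕ) : Expr
  | read (A : Arr) (e : Expr) : Expr
  | op (o : Op) (e₁ e₂ : Expr) : Expr

inductive Cmd where
  | skip : Cmd
  /-- register `x` gets the value of `e` -/
  | assign (x : ℕ) (e : Expr) : Cmd
  /-- cell `i` of the array `A` gets the value of `e` -/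
  | store (A : Arr) (i e : Expr) : Cmd
  | output (e : Expr) : Cmd
  | seq (c₁ c₂ : Cmd) : Cmd
  /-- `c₁` if the value of `e` is not `0`, else `c₂` -/
  | cond (e : Expr) (c₁ c₂ : Cmd) : Cmd
  /-- repeat `c` as long as the value of `e` is not `0` -/
  | loop (e : Expr) (c : Cmd) : Cmd

/-- The registers and arrays, and two records that a program cannot read: the time spent so far and
the words written to the output so far, each with the time at which it was written. -/
structure State where
  reg : ℕ → ℕ
  arr : Arr → ℕ → ℕ
  clock : ℕ
  out : List (ℕ × ℕ)

/-- A number, if it fits into a word. -/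
def word (W x : ℕ) : Option ℕ := if x < W then some x else none

def Expr.eval (W : ℕ) (s : State) : Expr → Option ℕ
  | .const c => word W c
  | .reg x => word W (s.reg x)
  | .read A e => (e.eval W s).bind fun i => word W (s.arr A i)
  | .op o e₁ e₂ => (e₁.eval W s).bind fun x => (e₂.eval W s).bind fun y => word W (o.apply x y)

/-- The time for the evaluation of an expression: the number of its operations and accesses. -/
def Expr.cost : Expr → ℕ
  | .const _ => 1
  | .reg _ => 1
  | .read _ e => e.cost + 1
  | .op _ e₁ e₂ => e₁.cost + e₂.cost + 1

def State.tick (s : State) (t : ℕ) : State := { s with clock := s.clock + t }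

/-- `Exec W c s s'`: on words below `W`, the program `c` started in the state `s` runs without
overflow and halts in the state `s'`. -/
inductive Exec (W : ℕ) : Cmd → State → State → Prop
  | skip (s : State) : Exec W .skip s (s.tick 1)
  | assign (s : State) (x : ℕ) (e : Expr) (v : ℕ) : e.eval W s = some v →
      Exec W (.assign x e) s
        { s with reg := Function.update s.reg x v, clock := s.clock + (e.cost + 1) }
  | store (s : State) (A : Arr) (i e : Expr) (k v : ℕ) :
      i.eval W s = some k → e.eval W s = some v →
      Exec W (.store A i e) s
        { s with
          arr := Function.update s.arr A (Function.update (s.arr A) k v)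
          clock := s.clock + (i.cost + e.cost + 1) }
  | output (s : State) (e : Expr) (v : ℕ) : e.eval W s = some v →
      Exec W (.output e) s
        { s with
          clock := s.clock + (e.cost + 1)
          out := s.out ++ [(s.clock + (e.cost + 1), v)] }
  | seq (c₁ c₂ : Cmd) (s s' s'' : State) :
      Exec W c₁ s s' → Exec W c₂ s' s'' → Exec W (.seq c₁ c₂) s s''
  | cond_true (e : Expr) (c₁ c₂ : Cmd) (s s' : State) (v : ℕ) :
      e.eval W s = some v → v ≠ 0 → Exec W c₁ (s.tick (e.cost + 1)) s' →
      Exec W (.cond e c₁ c₂) s s'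
  | cond_false (e : Expr) (c₁ c₂ : Cmd) (s s' : State) :
      e.eval W s = some 0 → Exec W c₂ (s.tick (e.cost + 1)) s' →
      Exec W (.cond e c₁ c₂) s s'
  | loop_true (e : Expr) (c : Cmd) (s s' s'' : State) (v : ℕ) :
      e.eval W s = some v → v ≠ 0 → Exec W c (s.tick (e.cost + 1)) s' →
      Exec W (.loop e c) s' s'' → Exec W (.loop e c) s s''
  | loop_false (e : Expr) (c : Cmd) (s : State) :
      e.eval W s = some 0 → Exec W (.loop e c) s (s.tick (e.cost + 1))

/-! ### Input and output -/

/-- The letters are the numbers `1, …, σ`. -/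
def code {σ : ℕ} (v : List (Fin σ)) : List ℕ := v.map fun a => (a : ℕ) + 1

/-- The array that starts with the given list and continues with zeros. -/
def load (l : List ℕ) : ℕ → ℕ := fun i => l.getD i 0

/-- The word `w`, preceded by its length and the size of the alphabet. -/
def inputArray {σ : ℕ} (w : List (Fin σ)) : ℕ → ℕ := load (w.length :: σ :: code w)

/-- The initial state for the input `w`. -/
def initial {σ : ℕ} (w : List (Fin σ)) : State where
  reg := fun _ => 0
  arr := fun A => if A = .input then inputArray w else fun _ => 0
  clock := 0
  out := []

/-- `s'` has the same input word and the same data structures as `s`. -/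
def SameData (s s' : State) : Prop :=
  s'.arr .input = s.arr .input ∧ ∀ k, s'.arr (.data k) = s.arr (.data k)

/-- A state `s` in which a query to the data structures in `s₁` may start. The registers and the
arrays `work` may hold anything, for example what earlier queries have left there. -/
def IsQueryStart (s₁ s : State) : Prop := SameData s₁ s ∧ s.clock = 0 ∧ s.out = []

/-- On words below `W`, the program `c` started in `s` halts in a state that satisfies `Q`, and it
leaves the input word and the data structures as they were. -/
def Answers (W : ℕ) (c : Cmd) (s : State) (Q : State → Prop) : Prop :=
  ∃ s' : State, Exec W c s s' ∧ SameData s s' ∧ Q s'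

/-- The words on the output. -/
def State.written (s : State) : List ℕ := s.out.map Prod.snd

/-- The output is the truth value of `P`. -/
def State.Decides (s : State) (P : Prop) : Prop :=
  (P ∧ s.written = [1]) ∨ (¬ P ∧ s.written = [0])

/-- The output consists of the elements of `S`, each of them once and followed by the end mark `0`,
and the time until the first end mark, between consecutive ones, and from the last one
to the end of the computation is at most `d`. -/
def State.Enumerates {σ : ℕ} (s : State) (S : Set (List (Fin σ))) (d : ℕ) : Prop :=
  (∃ L : List (List (Fin σ)), L.Nodup ∧ (∀ v, v ∈ L ↔ v ∈ S) ∧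
    s.written = L.flatMap fun v => code v ++ [0]) ∧
  List.IsChain (fun t t' => t' ≤ t + d)
    (0 :: (s.out.filter fun p => p.2 = 0).map Prod.fst ++ [s.clock])

end MASRep

/-!
A path from the source spells a word `v` and ends in the node `(i, j)`, where `i` is the end of
the leftmost embedding of `v` into `w` and `j` is the end of the leftmost embedding of `v` without
its last letter. A word `u` completes `v` to an MAS if and only if `u` is an MAS of the suffix of
`w` after `i` and embeds into the suffix after `j`, the second condition being void at the source.
For `u` with first letter `a` this says that there is an edge with label `a`, and that the
remaining letters of `u` complete the node that it leads to. Thus the paths to the sink spell the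
MAS, each of them once, and `i` increases along the edges.

With the edges in a table, an MAS is recognized by following its letters, the lengths of the paths
to the sink are found by dynamic programming over the nodes, and a depth-first search lists the
MAS. The search has no dead ends, since every node has an outgoing edge, so that it writes a word
at least once in every `2 (n + 1)` visits of nodes.
-/

namespace MASRep

section Words

variable {σ : ℕ} {w u v : List (Fin σ)} {i j k : ℕ} {a : Fin σ}

/-- The leftmost position after `i` that carries `a`, or `w.length + 1` if there is none. -/
def nextPos (w : List (Fin σ)) (i : ℕ) (a : Fin σ) : ℕ := i + (w.drop i).idxOf a + 1

theorem lt_nextPos : i < nextPos w i a := by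
  unfold nextPos; omega

theorem nextPos_le (hi : i ≤ w.length) : nextPos w i a ≤ w.length + 1 := by
  have := List.idxOf_le_length (a := a) (l := w.drop i)
  rw [List.length_drop] at this
  unfold nextPos; omega

theorem nextPos_length : nextPos w w.length a = w.length + 1 := by
  simp [nextPos]

theorem nextPos_eq_ite (hi : i < w.length) :
    nextPos w i a = if w[i] = a then i + 1 else nextPos w (i + 1) a := by
  rw [nextPos, nextPos, List.drop_eq_getElem_cons hi, List.idxOf_cons]
  by_cases h : w[i] = a
  · simp [h]
  · simp only [beq_false_of_ne h, cond_false, h, if_false]; omega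

theorem nextPos_eq_of_le (hj : j ≤ w.length) (hji : j ≤ i) (hij : i < nextPos w j a) :
    nextPos w i a = nextPos w j a := by
  induction i, hji using Nat.le_induction with
  | base => rfl
  | succ i _ ih =>
    have hle := nextPos_le (a := a) hj
    have hi := ih (by omega)
    rw [nextPos_eq_ite (by omega)] at hi
    split_ifs at hi
    · omega
    · exact hi

theorem mem_drop_iff (hi : i ≤ w.length) : a ∈ w.drop i ↔ nextPos w i a ≤ w.length := by
  rw [← List.idxOf_lt_length_iff, List.length_drop, nextPos]; omega

theorem mem_factor_iff (hji : j ≤ i) (hi : i ≤ w.length) :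
    a ∈ factor w j i ↔ nextPos w j a ≤ i := by
  have hdrop := mem_drop_iff (a := a) (hji.trans hi)
  have hfactor : factor w j i = (w.drop j).take (i - j) := List.drop_take
  rw [hfactor]
  by_cases ha : a ∈ w.drop j
  · rw [List.mem_take_iff_idxOf_lt ha, nextPos]; omega
  · have hnext : ¬ nextPos w j a ≤ i := fun h => ha (hdrop.2 (h.trans hi))
    exact iff_of_false (fun h => ha (List.mem_of_mem_take h)) hnext

theorem isNext_nextPos (h : nextPos w i a ≤ w.length) : IsNext w i a (nextPos w i a) := by
  have hlt : (w.drop i).idxOf a < (w.drop i).length := by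
    rw [List.length_drop]; unfold nextPos at h; omega
  refine ⟨lt_nextPos, ?_, fun l hil hl hla => ?_⟩
  · have hget := List.getElem?_idxOf (List.idxOf_lt_length_iff.1 hlt)
    rwa [List.getElem?_drop] at hget
  · have hget : (w.drop i)[l - 1 - i]? = some a := by
      rw [List.getElem?_drop, ← hla]; congr 1; omega
    obtain ⟨hm, hget⟩ := List.getElem?_eq_some_iff.1 hget
    have hmin := (List.findIdx_eq hlt).1 (rfl : (w.drop i).findIdx (· == a) = _)
    have hne := hmin.2 (l - 1 - i) (by unfold nextPos at hl; omega)
    simp [hget] at hne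

theorem IsNext.right_unique {k' : ℕ} (h : IsNext w i a k) (h' : IsNext w i a k') : k = k' := by
  rcases lt_trichotomy k k' with hlt | heq | hlt
  · exact absurd h.2.1 (h'.2.2 k h.1 hlt)
  · exact heq
  · exact absurd h'.2.1 (h.2.2 k' h'.1 hlt)

theorem IsNext.mem_drop (h : IsNext w i a k) : a ∈ w.drop i := by
  have hik := h.1
  refine List.mem_of_getElem? (i := k - 1 - i) ?_
  rw [List.getElem?_drop, ← h.2.1]; congr 1; omega

theorem isNext_iff (hi : i ≤ w.length) :
    IsNext w i a k ↔ nextPos w i a = k ∧ k ≤ w.length := by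
  constructor
  · intro h
    have hle := (mem_drop_iff hi).1 h.mem_drop
    have heq := (isNext_nextPos hle).right_unique h
    exact ⟨heq, heq ▸ hle⟩
  · rintro ⟨rfl, h⟩
    exact isNext_nextPos h

theorem cons_sublist_drop_iff (hi : i ≤ w.length) :
    (a :: u).Sublist (w.drop i) ↔
      nextPos w i a ≤ w.length ∧ u.Sublist (w.drop (nextPos w i a)) := by
  induction hi using Nat.decreasingInduction with
  | self => simp [nextPos_length]
  | of_succ i hi ih =>
    rw [nextPos_eq_ite hi, List.drop_eq_getElem_cons hi]
    split_ifs with hwi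
    · rw [hwi, List.cons_sublist_cons]
      exact (and_iff_right hi).symm
    · rw [← ih]
      refine ⟨fun h => ?_, fun h => h.cons _⟩
      cases h with
      | cons _ h => exact h
      | cons_cons _ h => exact absurd rfl hwi

theorem cons_sublist_drop_of_lt_nextPos (hi : i ≤ w.length) (hj : j ≤ w.length)
    (hij : i < nextPos w j a) (h : (a :: u).Sublist (w.drop j)) :
    (a :: u).Sublist (w.drop i) := by
  rcases Nat.le_total j i with hji | hle
  · rwa [cons_sublist_drop_iff hi, nextPos_eq_of_le hj hji hij, ← cons_sublist_drop_iff hj]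
  · exact h.trans (List.drop_sublist_drop_left w hle)

theorem isMAS_drop_cons_iff (hi : i ≤ w.length) :
    IsMAS (w.drop i) (a :: u) ↔
      (nextPos w i a = w.length + 1 ∧ u = []) ∨
      (nextPos w i a ≤ w.length ∧ IsMAS (w.drop (nextPos w i a)) u ∧ u.Sublist (w.drop i)) := by
  have hle := nextPos_le (a := a) hi
  constructor
  · rintro ⟨hnot, hproper⟩
    rw [cons_sublist_drop_iff hi] at hnot
    have hcons : ∀ v, v.Sublist u → v ≠ u → nextPos w i a ≤ w.length ∧
        v.Sublist (w.drop (nextPos w i a)) := fun v hv hne =>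
      (cons_sublist_drop_iff hi).1 (hproper _ (hv.cons_cons a) (by simpa using hne))
    rcases Nat.lt_or_ge w.length (nextPos w i a) with hlt | hge
    · refine Or.inl ⟨by omega, ?_⟩
      by_contra hu
      have := (hcons [] (by simp) (Ne.symm hu)).1
      omega
    · exact Or.inr ⟨hge, ⟨fun hu => hnot ⟨hge, hu⟩, fun v hv hne => (hcons v hv hne).2⟩,
        hproper u (List.sublist_cons_self a u) (List.cons_ne_self a u).symm⟩
  · rintro (⟨hnext, rfl⟩ | ⟨hnext, hu, hui⟩)
    · refine ⟨fun h => ?_, fun v hv hne => ?_⟩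
      · rw [cons_sublist_drop_iff hi] at h; omega
      · rcases List.sublist_singleton.1 hv with rfl | rfl
        · exact List.nil_sublist _
        · exact absurd rfl hne
    · refine ⟨fun h => hu.1 ((cons_sublist_drop_iff hi).1 h).2, fun v hv hne => ?_⟩
      cases hv with
      | cons _ hv => exact hv.trans hui
      | cons_cons _ hv =>
        rename_i v
        exact (cons_sublist_drop_iff hi).2 ⟨hnext, hu.2 v hv fun h => hne (by rw [h])⟩

/-! ### Edges, paths and the words they spell -/

/-- The target of the edge with label `a` out of `(i, j)`, encoded as in `StoresGraph`: `k` for the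
node `(k, i)`, `w.length + 1` for the sink, and `0` if there is no such edge. -/
def target (w : List (Fin σ)) (i j : ℕ) (a : Fin σ) : ℕ :=
  if i = 0 ∨ nextPos w j a ≤ i then nextPos w i a else 0

theorem target_of_enabled (h : i = 0 ∨ nextPos w j a ≤ i) : target w i j a = nextPos w i a :=
  if_pos h

theorem target_of_not_enabled (h : ¬ (i = 0 ∨ nextPos w j a ≤ i)) : target w i j a = 0 :=
  if_neg h

theorem target_le (hi : i ≤ w.length) : target w i j a ≤ w.length + 1 := by
  unfold target
  split_ifs
  · exact nextPos_le hi
  · exact Nat.zero_le _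

theorem lt_target (h : target w i j a ≠ 0) : i < target w i j a := by
  unfold target at *
  split_ifs at *
  · exact lt_nextPos
  · exact absurd rfl h

theorem target_ne_zero_iff : target w i j a ≠ 0 ↔ i = 0 ∨ nextPos w j a ≤ i := by
  have := lt_nextPos (w := w) (i := i) (a := a)
  unfold target
  split_ifs with h <;> simp only [h, iff_true, iff_false] <;> omega

theorem isPair_target (h : target w i j a ≠ 0) (h' : target w i j a ≤ w.length) :
    IsPair w.length (target w i j a) i :=
  Or.inl ⟨lt_target h, h'⟩

theorem IsPair.fst_le (h : IsPair k i j) : i ≤ k := by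
  unfold IsPair at h; omega

theorem IsPair.snd_le (h : IsPair k i j) : j ≤ k := by
  unfold IsPair at h; omega

theorem isPair_zero : IsPair k 0 0 := Or.inr ⟨rfl, rfl⟩

theorem exists_target_ne_zero (hσ : 1 ≤ σ) (hp : IsPair w.length i j) :
    ∃ a, target w i j a ≠ 0 := by
  simp only [target_ne_zero_iff]
  rcases hp with ⟨hji, hi⟩ | ⟨rfl, rfl⟩
  · refine ⟨w[i - 1], Or.inr ((mem_factor_iff hji.le hi).1
      (List.mem_of_getElem? (i := i - 1 - j) ?_))⟩
    rw [factor, List.getElem?_drop, List.getElem?_take_of_lt (by omega),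
      List.getElem?_eq_getElem (by omega)]
    congr 2; omega
  · exact ⟨⟨0, hσ⟩, Or.inl rfl⟩

theorem edge_iff (hp : IsPair w.length i j) {y : Node} :
    Edge w (.pos i j) a y ↔
      (target w i j a = w.length + 1 ∧ y = .sink) ∨
      (target w i j a ≠ 0 ∧ target w i j a ≤ w.length ∧ y = .pos (target w i j a) i) := by
  have hi := hp.fst_le
  have hlt := lt_nextPos (w := w) (i := i) (a := a)
  have hsink : a ∉ w.drop i ↔ nextPos w i a = w.length + 1 := by
    have := nextPos_le (a := a) hi
    rw [mem_drop_iff hi]; omega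
  have hfactor : factor w i w.length = w.drop i := by rw [factor, List.take_length]
  constructor
  · intro h
    have henabled : i = 0 ∨ nextPos w j a ≤ i := by
      cases h with
      | start | absent => exact Or.inl rfl
      | step _ _ _ _ hji hf | final _ _ _ hji _ hf =>
        exact Or.inr ((mem_factor_iff (Nat.le_of_lt hji) hi).1 hf)
    rw [target_of_enabled henabled]
    cases h with
    | start _ k h | step _ _ _ k _ _ h =>
      obtain ⟨rfl, hk⟩ := (isNext_iff hi).1 h
      exact Or.inr ⟨by omega, hk, rfl⟩
    | final _ _ _ _ _ _ h => exact Or.inl ⟨hsink.1 (hfactor ▸ h), rfl⟩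
    | absent _ h => exact Or.inl ⟨hsink.1 h, rfl⟩
  · intro h
    have henabled : i = 0 ∨ nextPos w j a ≤ i := target_ne_zero_iff.1 (by omega)
    rw [target_of_enabled henabled] at h
    rcases hp with ⟨hji, _⟩ | ⟨rfl, rfl⟩
    · have hf := (mem_factor_iff hji.le hi).2 (henabled.resolve_left (by omega))
      rcases h with ⟨h, rfl⟩ | ⟨_, h, rfl⟩
      · exact .final _ _ _ hji hi hf (hfactor ▸ hsink.2 h)
      · exact .step _ _ _ _ hji hf (isNext_nextPos h)
    · rcases h with ⟨h, rfl⟩ | ⟨_, h, rfl⟩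
      · exact .absent _ (hsink.2 h)
      · exact .start _ _ (isNext_nextPos h)

/-- `u` is spelled by some path from `(i, j)` to the sink (see `exists_isPath_iff`), in terms of
subsequences. -/
def Completes (w : List (Fin σ)) (i j : ℕ) (u : List (Fin σ)) : Prop :=
  IsMAS (w.drop i) u ∧ (i = 0 ∨ u.Sublist (w.drop j))

theorem completes_zero : Completes w 0 j u ↔ IsMAS w u := by simp [Completes]

theorem not_completes_nil : ¬ Completes w i j [] := by simp [Completes, IsMAS]

theorem completes_cons_iff (hi : i ≤ w.length) (hj : j ≤ w.length) :
    Completes w i j (a :: u) ↔ (target w i j a = w.length + 1 ∧ u = []) ∨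
      (target w i j a ≠ 0 ∧ target w i j a ≤ w.length ∧ Completes w (target w i j a) i u) := by
  have hlt := lt_nextPos (w := w) (i := i) (a := a)
  by_cases henabled : i = 0 ∨ nextPos w j a ≤ i
  · have hprefix : u.Sublist (w.drop i) → i = 0 ∨ (a :: u).Sublist (w.drop j) := fun hu =>
      henabled.imp_right fun h => (cons_sublist_drop_iff hj).2
        ⟨h.trans hi, hu.trans (List.drop_sublist_drop_left w h)⟩
    rw [target_of_enabled henabled, Completes, Completes, isMAS_drop_cons_iff hi]
    constructor
    · rintro ⟨h | ⟨hnext, hmas, hu⟩, -⟩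
      · exact Or.inl h
      · exact Or.inr ⟨by omega, hnext, hmas, Or.inr hu⟩
    · rintro (⟨hnext, rfl⟩ | ⟨-, hnext, hmas, hu⟩)
      · exact ⟨Or.inl ⟨hnext, rfl⟩, hprefix (List.nil_sublist _)⟩
      · have hu := hu.resolve_left (by omega)
        exact ⟨Or.inr ⟨hnext, hmas, hu⟩, hprefix hu⟩
  · rw [target_of_not_enabled henabled]
    push Not at henabled
    refine iff_of_false (fun h => h.1.1 ?_) (by simp)
    exact cons_sublist_drop_of_lt_nextPos hi hj henabled.2 (h.2.resolve_left henabled.1)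

theorem Completes.add_length_le (hi : i ≤ w.length) (hj : j ≤ w.length) (h : Completes w i j u) :
    i + u.length ≤ w.length + 1 := by
  induction u generalizing i j with
  | nil => exact absurd h not_completes_nil
  | cons a u ih =>
    rw [List.length_cons]
    rcases (completes_cons_iff hi hj).1 h with ⟨-, rfl⟩ | ⟨hne, hle, hu⟩
    · rw [List.length_nil]; omega
    · have := ih hle hi hu
      have := lt_target hne
      omega

theorem IsMAS.length_le (h : IsMAS w u) : u.length ≤ w.length + 1 := by
  simpa using Completes.add_length_le (j := 0) (Nat.zero_le _) (Nat.zero_le _)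
    (completes_zero.2 h)

theorem Edge.right_unique {x y z : Node} (h : Edge w x a y) (h' : Edge w x a z) : y = z := by
  have hfactor : ∀ i, factor w i w.length = w.drop i := fun i => by rw [factor, List.take_length]
  cases h with
  | start _ k h =>
    cases h' with
    | start _ k' h' => rw [h.right_unique h']
    | step _ _ _ _ h' => exact absurd h' (lt_irrefl 0)
    | final _ _ _ h' => exact absurd h' (lt_irrefl 0)
    | absent _ h' => exact absurd h.mem_drop h'
  | step i j _ k hji _ h =>
    cases h' with
    | start => exact absurd hji (lt_irrefl 0)
    | step _ _ _ _ _ _ h' => rw [h.right_unique h']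
    | final _ _ _ _ _ _ h' => exact absurd h.mem_drop (hfactor i ▸ h')
    | absent => exact absurd hji (lt_irrefl 0)
  | final i j _ hji _ _ h =>
    cases h' with
    | start => exact absurd hji (lt_irrefl 0)
    | step _ _ _ _ _ _ h' => exact absurd h'.mem_drop (hfactor i ▸ h)
    | final | absent => rfl
  | absent _ h =>
    cases h' with
    | start _ _ h' => exact absurd h'.mem_drop h
    | step _ _ _ _ h' => exact absurd h' (lt_irrefl 0)
    | final | absent => rfl

theorem not_edge_sink {y : Node} : ¬ Edge w .sink a y := by
  intro h; cases h

theorem IsPath.eq_nil_of_sink {p : List (Fin σ × Node)} {y : Node} (h : IsPath w .sink p y) :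
    p = [] := by
  cases p with
  | nil => rfl
  | cons _ _ => exact absurd h.1 not_edge_sink

theorem IsPath.eq_of_label_eq {x : Node} {p q : List (Fin σ × Node)} (hp : IsPath w x p .sink)
    (hq : IsPath w x q .sink) (h : label p = label q) : p = q := by
  induction p generalizing x q with
  | nil =>
    exact (List.map_eq_nil_iff.1 h.symm).symm
  | cons e p ih =>
    cases q with
    | nil => exact absurd h (by simp [label])
    | cons e' q =>
      obtain ⟨b, y⟩ := e
      obtain ⟨b', y'⟩ := e'
      obtain ⟨rfl, htail⟩ := List.cons.inj h
      obtain rfl := hp.1.right_unique hq.1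
      rw [ih hp.2 hq.2 htail]

theorem exists_isPath_cons_iff {x y : Node} :
    (∃ p, IsPath w x p y ∧ label p = a :: u) ↔
      ∃ z, Edge w x a z ∧ ∃ p, IsPath w z p y ∧ label p = u := by
  constructor
  · rintro ⟨_ | ⟨⟨b, z⟩, p⟩, hp, hl⟩
    · cases hl
    · obtain ⟨rfl, rfl⟩ := List.cons.inj hl
      exact ⟨z, hp.1, p, hp.2, rfl⟩
  · rintro ⟨z, he, p, hp, rfl⟩
    exact ⟨(a, z) :: p, ⟨he, hp⟩, rfl⟩

theorem exists_isPath_iff (hp : IsPair w.length i j) :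
    (∃ p, IsPath w (.pos i j) p .sink ∧ label p = u) ↔ Completes w i j u := by
  induction u generalizing i j with
  | nil =>
    refine iff_of_false ?_ not_completes_nil
    rintro ⟨p, hp, hl⟩
    obtain rfl := List.map_eq_nil_iff.1 hl
    cases hp
  | cons a u ih =>
    rw [exists_isPath_cons_iff, completes_cons_iff hp.fst_le hp.snd_le]
    simp only [edge_iff hp]
    constructor
    · rintro ⟨_, ⟨ht, rfl⟩ | ⟨hne, hle, rfl⟩, hpath⟩
      · obtain ⟨p, hp, rfl⟩ := hpath
        exact Or.inl ⟨ht, by rw [hp.eq_nil_of_sink]; rfl⟩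
      · exact Or.inr ⟨hne, hle, (ih (isPair_target hne hle)).1 hpath⟩
    · rintro (⟨ht, rfl⟩ | ⟨hne, hle, hu⟩)
      · exact ⟨.sink, Or.inl ⟨ht, rfl⟩, [], rfl, rfl⟩
      · exact ⟨_, Or.inr ⟨hne, hle, rfl⟩, (ih (isPair_target hne hle)).2 hu⟩

theorem bijOn_label (w : List (Fin σ)) :
    Set.BijOn label {p | IsPath w (.pos 0 0) p .sink} {v | IsMAS w v} := by
  refine ⟨fun p hp => ?_, fun p hp q hq => hp.eq_of_label_eq hq, fun u hu => ?_⟩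
  · exact completes_zero.1 ((exists_isPath_iff isPair_zero).1 ⟨p, hp, rfl⟩)
  · exact (exists_isPath_iff isPair_zero).2 (completes_zero.2 hu)

/-- The first component of a node, with `n + 1` for the sink: it increases along every edge. -/
def Node.height (n : ℕ) : Node → ℕ
  | .pos i _ => i
  | .sink => n + 1

theorem Edge.height_lt {x y : Node} (h : Edge w x a y) :
    x.height w.length < y.height w.length := by
  cases h with
  | start _ _ h => exact h.1
  | step _ _ _ _ _ _ h => exact h.1
  | final _ _ _ _ hi => exact Nat.lt_succ_of_le hi
  | absent => exact Nat.succ_pos _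

theorem IsPath.height_add_length_le {x y : Node} {p : List (Fin σ × Node)} (h : IsPath w x p y) :
    x.height w.length + p.length ≤ y.height w.length := by
  induction p generalizing x with
  | nil => exact (congrArg (Node.height w.length) h).le
  | cons e p ih =>
    have hedge := h.1.height_lt
    have hpath := ih h.2
    rw [List.length_cons]; omega

theorem isAcyclic (w : List (Fin σ)) : IsAcyclic w := fun x p h =>
  List.eq_nil_of_length_eq_zero (by have := h.height_add_length_le; omega)

/-! ### Listing the words spelled from a node -/

/-- The words with first letter `a` that complete `(i, j)`, in lexicographic order. -/
def completionsVia (w : List (Fin σ)) (i j : ℕ) (a : Fin σ) : List (List (Fin σ)) :=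
  if target w i j a = w.length + 1 then [[a]]
  else if _h : target w i j a ≠ 0 ∧ target w i j a ≤ w.length then
    ((List.finRange σ).flatMap fun b => completionsVia w (target w i j a) i b).map (a :: ·)
  else []
termination_by w.length - i
decreasing_by
  have := lt_target _h.1
  omega

/-- The words that complete `(i, j)`, in lexicographic order. -/
def completions (w : List (Fin σ)) (i j : ℕ) : List (List (Fin σ)) :=
  (List.finRange σ).flatMap (completionsVia w i j)

theorem completionsVia_of_eq (h : target w i j a = w.length + 1) :
    completionsVia w i j a = [[a]] := by
  rw [completionsVia, if_pos h]

theorem completionsVia_of_le (h : target w i j a ≠ 0) (h' : target w i j a ≤ w.length) :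
    completionsVia w i j a = (completions w (target w i j a) i).map (a :: ·) := by
  rw [completionsVia, if_neg (by omega), dif_pos ⟨h, h'⟩, completions]

theorem completionsVia_of_eq_zero (h : target w i j a = 0) : completionsVia w i j a = [] := by
  rw [completionsVia, if_neg (by omega), dif_neg fun h' => h'.1 h]

theorem exists_eq_cons_of_mem_completionsVia (h : v ∈ completionsVia w i j a) :
    ∃ u, v = a :: u := by
  rw [completionsVia] at h
  split_ifs at h
  · exact ⟨[], List.mem_singleton.1 h⟩
  · obtain ⟨u, -, rfl⟩ := List.mem_map.1 h
    exact ⟨u, rfl⟩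
  · cases h

theorem cons_mem_completions_iff :
    a :: u ∈ completions w i j ↔ a :: u ∈ completionsVia w i j a := by
  refine ⟨fun h => ?_, fun h => List.mem_flatMap.2 ⟨a, List.mem_finRange a, h⟩⟩
  obtain ⟨b, -, hb⟩ := List.mem_flatMap.1 h
  obtain ⟨_, hcons⟩ := exists_eq_cons_of_mem_completionsVia hb
  exact (List.cons.inj hcons).1 ▸ hb

theorem mem_completions_iff (hi : i ≤ w.length) (hj : j ≤ w.length) :
    u ∈ completions w i j ↔ Completes w i j u := by
  induction u generalizing i j with
  | nil =>
    refine iff_of_false (fun h => ?_) not_completes_nil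
    obtain ⟨a, -, ha⟩ := List.mem_flatMap.1 h
    obtain ⟨_, hcons⟩ := exists_eq_cons_of_mem_completionsVia ha
    cases hcons
  | cons a u ih =>
    rw [cons_mem_completions_iff, completes_cons_iff hi hj]
    have hle := target_le (a := a) (j := j) hi
    rcases Nat.eq_zero_or_pos (target w i j a) with hzero | hpos
    · simp [completionsVia_of_eq_zero hzero, hzero]
    rcases Nat.lt_or_ge w.length (target w i j a) with hlt | hge
    · have hsink : target w i j a = w.length + 1 := by omega
      simp [completionsVia_of_eq hsink, hsink]
    · have hne : target w i j a ≠ w.length + 1 := by omega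
      simp [completionsVia_of_le hpos.ne' hge, ih hge hi, hne, hge, hpos.ne']

theorem pairwise_disjoint_completionsVia :
    (List.finRange σ).Pairwise (Function.onFun List.Disjoint (completionsVia w i j)) := by
  refine (List.nodup_finRange σ).imp fun hne v hv hv' => hne ?_
  obtain ⟨_, rfl⟩ := exists_eq_cons_of_mem_completionsVia hv
  obtain ⟨_, hcons⟩ := exists_eq_cons_of_mem_completionsVia hv'
  exact (List.cons.inj hcons).1

theorem nodup_completionsVia : (completionsVia w i j a).Nodup := by
  induction i, j, a using completionsVia.induct w with
  | case1 i j a h => simp only [completionsVia_of_eq h, List.nodup_singleton]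
  | case2 i j a _ h ih =>
    rw [completionsVia_of_le h.1 h.2]
    exact .map List.cons_injective
      (List.nodup_flatMap.2 ⟨fun b _ => ih b, pairwise_disjoint_completionsVia⟩)
  | case3 i j a hn h => rw [completionsVia, if_neg hn, dif_neg h]; exact List.nodup_nil

theorem nodup_completions : (completions w i j).Nodup :=
  List.nodup_flatMap.2 ⟨fun _ _ => nodup_completionsVia, pairwise_disjoint_completionsVia⟩

end Words

/-! ### Total correctness of programs -/

section Programs

instance (c : ℕ) : OfNat Expr c := ⟨.const c⟩
instance : Add Expr := ⟨.op .add⟩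
instance : Sub Expr := ⟨.op .sub⟩
instance : Mul Expr := ⟨.op .mul⟩
instance : Div Expr := ⟨.op .div⟩
instance : Mod Expr := ⟨.op .mod⟩

infix:50 "<ₑ" => Expr.op Op.lt
infix:50 "=ₑ" => Expr.op Op.eq
infix:35 "::=" => Cmd.assign
infixr:30 ";;" => Cmd.seq

variable {W T : ℕ} {s s' : State} {c c₁ c₂ : Cmd} {P Q : State → Prop} {e e₁ e₂ : Expr} {A : Arr}
  {x : ℕ}

@[simp] theorem State.tick_reg (s : State) (t : ℕ) : (s.tick t).reg = s.reg := rfl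
@[simp] theorem State.tick_arr (s : State) (t : ℕ) : (s.tick t).arr = s.arr := rfl
@[simp] theorem State.tick_out (s : State) (t : ℕ) : (s.tick t).out = s.out := rfl
@[simp] theorem State.tick_clock (s : State) (t : ℕ) : (s.tick t).clock = s.clock + t := rfl

/-- The value of an expression when the word size is ignored. -/
def Expr.val (s : State) : Expr → ℕ
  | .const c => c
  | .reg x => s.reg x
  | .read A e => s.arr A (e.val s)
  | .op o e₁ e₂ => o.apply (e₁.val s) (e₂.val s)

/-- Every number that arises in the evaluation of an expression fits into a word. -/
def Expr.Fits (W : ℕ) (s : State) : Expr → Prop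
  | .const c => c < W
  | .reg x => s.reg x < W
  | .read A e => e.Fits W s ∧ s.arr A (e.val s) < W
  | .op o e₁ e₂ => e₁.Fits W s ∧ e₂.Fits W s ∧ o.apply (e₁.val s) (e₂.val s) < W

namespace Expr

@[simp] theorem val_ofNat (n : ℕ) : (no_index (OfNat.ofNat n) : Expr).val s = OfNat.ofNat n := rfl
@[simp] theorem val_reg : (reg x).val s = s.reg x := rfl
@[simp] theorem val_read : (read A e).val s = s.arr A (e.val s) := rfl
@[simp] theorem val_add : (e₁ + e₂).val s = e₁.val s + e₂.val s := rfl
@[simp] theorem val_sub : (e₁ - e₂).val s = e₁.val s - e₂.val s := rfl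
@[simp] theorem val_mul : (e₁ * e₂).val s = e₁.val s * e₂.val s := rfl
@[simp] theorem val_div : (e₁ / e₂).val s = e₁.val s / e₂.val s := rfl
@[simp] theorem val_mod : (e₁ % e₂).val s = e₁.val s % e₂.val s := rfl
@[simp] theorem val_lt : (e₁ <ₑ e₂).val s = if e₁.val s < e₂.val s then 1 else 0 := rfl
@[simp] theorem val_eq : (e₁ =ₑ e₂).val s = if e₁.val s = e₂.val s then 1 else 0 := rfl

theorem Fits.val_lt (h : e.Fits W s) : e.val s < W := by
  cases e with
  | const | reg => exact h
  | read => exact h.2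
  | op => exact h.2.2

@[simp] theorem fits_ofNat (n : ℕ) :
    (no_index (OfNat.ofNat n) : Expr).Fits W s ↔ (OfNat.ofNat n : ℕ) < W := .rfl
@[simp] theorem fits_reg : (reg x).Fits W s ↔ s.reg x < W := .rfl
@[simp] theorem fits_read : (read A e).Fits W s ↔ e.Fits W s ∧ s.arr A (e.val s) < W := .rfl
@[simp] theorem fits_add :
    (e₁ + e₂).Fits W s ↔ e₁.Fits W s ∧ e₂.Fits W s ∧ e₁.val s + e₂.val s < W := .rfl
@[simp] theorem fits_mul :
    (e₁ * e₂).Fits W s ↔ e₁.Fits W s ∧ e₂.Fits W s ∧ e₁.val s * e₂.val s < W := .rfl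

@[simp] theorem fits_sub : (e₁ - e₂).Fits W s ↔ e₁.Fits W s ∧ e₂.Fits W s :=
  ⟨fun h => ⟨h.1, h.2.1⟩, fun h => ⟨h.1, h.2, (Nat.sub_le _ _).trans_lt h.1.val_lt⟩⟩

@[simp] theorem fits_div : (e₁ / e₂).Fits W s ↔ e₁.Fits W s ∧ e₂.Fits W s :=
  ⟨fun h => ⟨h.1, h.2.1⟩, fun h => ⟨h.1, h.2, (Nat.div_le_self _ _).trans_lt h.1.val_lt⟩⟩

@[simp] theorem fits_mod : (e₁ % e₂).Fits W s ↔ e₁.Fits W s ∧ e₂.Fits W s :=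
  ⟨fun h => ⟨h.1, h.2.1⟩, fun h => ⟨h.1, h.2, (Nat.mod_le _ _).trans_lt h.1.val_lt⟩⟩

@[simp] theorem fits_lt : (e₁ <ₑ e₂).Fits W s ↔ e₁.Fits W s ∧ e₂.Fits W s := by
  refine ⟨fun h => ⟨h.1, h.2.1⟩, fun h => ⟨h.1, h.2, ?_⟩⟩
  have := h.2.val_lt
  simp only [Op.apply]; split_ifs <;> omega

@[simp] theorem fits_eq :
    (e₁ =ₑ e₂).Fits W s ↔ e₁.Fits W s ∧ e₂.Fits W s ∧ (e₁.val s = e₂.val s → 1 < W) := by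
  change _ ∧ _ ∧ (if e₁.val s = e₂.val s then 1 else 0) < W ↔ _
  refine and_congr_right fun h₁ => and_congr_right fun _ => ?_
  have := h₁.val_lt
  split_ifs with h <;> simp only [h, forall_const, false_implies, iff_true]; omega

@[simp] theorem val_tick {t : ℕ} : e.val (s.tick t) = e.val s := by
  induction e <;> simp_all only [val, State.tick_reg, State.tick_arr]

@[simp] theorem fits_tick {t : ℕ} : e.Fits W (s.tick t) ↔ e.Fits W s := by
  induction e <;> simp_all only [Fits, val_tick, State.tick_reg, State.tick_arr]

theorem Fits.eval_eq (h : e.Fits W s) : e.eval W s = some (e.val s) := by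
  induction e with
  | const | reg => exact if_pos h
  | read _ _ ih => rw [Expr.eval, ih h.1]; exact if_pos h.2
  | op _ _ _ ih₁ ih₂ => rw [Expr.eval, ih₁ h.1, ih₂ h.2.1]; exact if_pos h.2.2

end Expr

/-- What a program may modify: registers, arrays, and whether it may write to the output. -/
structure Footprint where
  regs : List ℕ
  arrs : List Arr
  outputs : Bool

instance : Append Footprint :=
  ⟨fun F F' => ⟨F.regs ++ F'.regs, F.arrs ++ F'.arrs, F.outputs || F'.outputs⟩⟩

theorem Footprint.append_regs (F F' : Footprint) : (F ++ F').regs = F.regs ++ F'.regs := rfl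

/-- The registers and arrays to which a program contains assignments, and whether it contains an
`output` command. -/
def Cmd.footprint : Cmd → Footprint
  | .skip => ⟨[], [], false⟩
  | .assign x _ => ⟨[x], [], false⟩
  | .store A _ _ => ⟨[], [A], false⟩
  | .output _ => ⟨[], [], true⟩
  | .seq c₁ c₂ | .cond _ c₁ c₂ => c₁.footprint ++ c₂.footprint
  | .loop _ c => c.footprint

/-- `s'` differs from `s` at most in the footprint `F` and in the time. -/
structure Frame (F : Footprint) (s s' : State) : Prop where
  reg : ∀ x ∉ F.regs, s'.reg x = s.reg x
  arr : ∀ A ∉ F.arrs, s'.arr A = s.arr A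
  out : F.outputs = false → s'.out = s.out

namespace Frame

variable {F F' : Footprint}

theorem of_eq (hr : s'.reg = s.reg) (ha : s'.arr = s.arr) (ho : s'.out = s.out) : Frame F s s' :=
  ⟨fun _ _ => by rw [hr], fun _ _ => by rw [ha], fun _ => ho⟩

theorem tick (s : State) (t : ℕ) : Frame F s (s.tick t) := of_eq rfl rfl rfl

theorem assign {v t : ℕ} :
    Frame ⟨[x], [], false⟩ s { s with reg := Function.update s.reg x v, clock := t } :=
  ⟨fun _ hy => Function.update_of_ne (by simpa using hy) _ _, fun _ _ => rfl, fun _ => rfl⟩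

theorem trans {s'' : State} (h : Frame F s s') (h' : Frame F s' s'') : Frame F s s'' :=
  ⟨fun x hx => (h'.reg x hx).trans (h.reg x hx), fun A hA => (h'.arr A hA).trans (h.arr A hA),
    fun hF => (h'.out hF).trans (h.out hF)⟩

theorem append_left (h : Frame F s s') : Frame (F ++ F') s s' :=
  ⟨fun x hx => h.reg x fun hx' => hx (List.mem_append_left _ hx'),
    fun A hA => h.arr A fun hA' => hA (List.mem_append_left _ hA'),
    fun hF => h.out (Bool.or_eq_false_iff.1 hF).1⟩

theorem append_right (h : Frame F' s s') : Frame (F ++ F') s s' :=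
  ⟨fun x hx => h.reg x fun hx' => hx (List.mem_append_right _ hx'),
    fun A hA => h.arr A fun hA' => hA (List.mem_append_right _ hA'),
    fun hF => h.out (Bool.or_eq_false_iff.1 hF).2⟩

end Frame

theorem Exec.frame (h : Exec W c s s') : Frame c.footprint s s' := by
  induction h with
  | skip | loop_false => exact .of_eq rfl rfl rfl
  | assign => exact .assign
  | store =>
    exact ⟨fun _ _ => rfl, fun _ hB => Function.update_of_ne (mt List.mem_singleton.2 hB) _ _,
      fun _ => rfl⟩
  | output => exact ⟨fun _ _ => rfl, fun _ _ => rfl, fun h => by cases h⟩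
  | seq _ _ _ _ _ _ _ ih₁ ih₂ => exact ih₁.append_left.trans ih₂.append_right
  | cond_true _ _ _ _ _ _ _ _ _ ih => exact (Frame.tick _ _).trans ih.append_left
  | cond_false _ _ _ _ _ _ _ ih => exact (Frame.tick _ _).trans ih.append_right
  | loop_true _ _ _ _ _ _ _ _ _ _ ih₁ ih₂ => exact (Frame.tick _ _).trans (ih₁.trans ih₂)

/-- The program `c` started in `s` halts without overflow after at most `T` steps, in a state that
satisfies `Q`. -/
def Runs (W T : ℕ) (c : Cmd) (s : State) (Q : State → Prop) : Prop :=
  ∃ s', Exec W c s s' ∧ s'.clock ≤ s.clock + T ∧ Q s'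

namespace Runs

theorem mono_time {T' : ℕ} (h : Runs W T c s Q) (hT : T ≤ T') : Runs W T' c s Q := by
  obtain ⟨s', hexec, htime, hQ⟩ := h
  exact ⟨s', hexec, by omega, hQ⟩

theorem imp (h : Runs W T c s P) (hPQ : ∀ s', Frame c.footprint s s' → P s' → Q s') :
    Runs W T c s Q := by
  obtain ⟨s', hexec, htime, hP⟩ := h
  exact ⟨s', hexec, htime, hPQ s' hexec.frame hP⟩

theorem skip (h : Q (s.tick 1)) (hT : 1 ≤ T := by decide) : Runs W T .skip s Q :=
  mono_time ⟨_, .skip s, le_rfl, h⟩ hT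

theorem assign (he : e.Fits W s)
    (h : Q { s with reg := Function.update s.reg x (e.val s), clock := s.clock + (e.cost + 1) })
    (hT : e.cost + 1 ≤ T := by decide) : Runs W T (x ::= e) s Q :=
  mono_time ⟨_, .assign s x e _ he.eval_eq, le_rfl, h⟩ hT

theorem store (hi : e₁.Fits W s) (he : e₂.Fits W s)
    (h : Q { s with
      arr := Function.update s.arr A (Function.update (s.arr A) (e₁.val s) (e₂.val s))
      clock := s.clock + (e₁.cost + e₂.cost + 1) })
    (hT : e₁.cost + e₂.cost + 1 ≤ T := by decide) : Runs W T (.store A e₁ e₂) s Q :=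
  mono_time ⟨_, .store s A e₁ e₂ _ _ hi.eval_eq he.eval_eq, le_rfl, h⟩ hT

theorem output (he : e.Fits W s)
    (h : Q { s with
      clock := s.clock + (e.cost + 1), out := s.out ++ [(s.clock + (e.cost + 1), e.val s)] })
    (hT : e.cost + 1 ≤ T := by decide) : Runs W T (.output e) s Q :=
  mono_time ⟨_, .output s e _ he.eval_eq, le_rfl, h⟩ hT

theorem seq {T₁ T₂ : ℕ} (h : Runs W T₁ c₁ s P)
    (h' : ∀ s', Frame c₁.footprint s s' → P s' → Runs W T₂ c₂ s' Q) :
    Runs W (T₁ + T₂) (c₁ ;; c₂) s Q := by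
  obtain ⟨s', hexec, htime, hP⟩ := h
  obtain ⟨s'', hexec', htime', hQ⟩ := h' s' hexec.frame hP
  exact ⟨s'', .seq _ _ _ _ _ hexec hexec', by omega, hQ⟩

theorem assign_seq (he : e.Fits W s)
    (h : Runs W (T - (e.cost + 1)) c { s with
      reg := Function.update s.reg x (e.val s), clock := s.clock + (e.cost + 1) } Q)
    (hT : e.cost + 1 ≤ T := by decide) : Runs W T (x ::= e ;; c) s Q :=
  (seq (assign (Q := fun s' => Runs W (T - (e.cost + 1)) c s' Q) he h le_rfl) fun _ _ h => h)
    |>.mono_time (by omega)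

theorem cond {p : Prop} (he : e.Fits W s) (hp : e.val s ≠ 0 ↔ p)
    (h₁ : p → Runs W (T - (e.cost + 1)) c₁ (s.tick (e.cost + 1)) Q)
    (h₂ : ¬ p → Runs W (T - (e.cost + 1)) c₂ (s.tick (e.cost + 1)) Q)
    (hT : e.cost + 1 ≤ T := by decide) : Runs W T (.cond e c₁ c₂) s Q := by
  by_cases h : p
  · obtain ⟨s', hexec, htime, hQ⟩ := h₁ h
    exact ⟨s', .cond_true _ _ _ _ _ _ he.eval_eq (hp.2 h) hexec,
      by simp only [State.tick_clock] at htime; omega, hQ⟩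
  · obtain ⟨s', hexec, htime, hQ⟩ := h₂ h
    exact ⟨s', .cond_false _ _ _ _ _ (by rw [he.eval_eq, not_not.1 (mt hp.1 h)]) hexec,
      by simp only [State.tick_clock] at htime; omega, hQ⟩

theorem loop_true {T₁ T₂ : ℕ} (he : e.Fits W s) (hv : e.val s ≠ 0)
    (h : Runs W T₁ c (s.tick (e.cost + 1)) P)
    (h' : ∀ s', Frame c.footprint s s' → P s' → Runs W T₂ (.loop e c) s' Q) :
    Runs W (e.cost + 1 + T₁ + T₂) (.loop e c) s Q := by
  obtain ⟨s', hexec, htime, hP⟩ := h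
  obtain ⟨s'', hexec', htime', hQ⟩ := h' s' ((Frame.tick _ _).trans hexec.frame) hP
  exact ⟨s'', .loop_true _ _ _ _ _ _ he.eval_eq hv hexec hexec',
    by simp only [State.tick_clock] at htime; omega, hQ⟩

theorem loop_false (he : e.Fits W s) (hv : e.val s = 0) (h : Q (s.tick (e.cost + 1))) :
    Runs W (e.cost + 1) (.loop e c) s Q :=
  ⟨_, .loop_false _ _ _ (by rw [he.eval_eq, hv]), le_rfl, h⟩

end Runs

/-- Run `c` with `0, 1, …` in register `x`, as long as this is below the value of register `b`. -/
def forLoop (x b : ℕ) (c : Cmd) : Cmd :=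
  x ::= 0 ;; .loop (.reg x <ₑ .reg b) (c ;; x ::= .reg x + 1)

theorem Runs.loop_counter {I : ℕ → State → Prop} {b N t : ℕ} (hx : x ∉ c.footprint.regs)
    (hb : b ∉ c.footprint.regs) (hxb : b ≠ x) (hN : N < W)
    (hI : ∀ t s s', Frame ⟨[x], [], false⟩ s s' → I t s → I t s')
    (step : ∀ t s', t < N → s'.reg x = t → Frame (forLoop x b c).footprint s s' → I t s' →
      Runs W T c s' (I (t + 1)))
    (ht : t ≤ N) (hs : Frame (forLoop x b c).footprint s s') (hxs : s'.reg x = t)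
    (hbs : s'.reg b = N) (hIs : I t s') :
    Runs W ((N - t) * (T + 8) + 4) (.loop (.reg x <ₑ .reg b) (c ;; x ::= .reg x + 1)) s' (I N) := by
  have hguard : (.reg x <ₑ .reg b : Expr).Fits W s' := by simp; omega
  induction ht using Nat.decreasingInduction generalizing s' with
  | self =>
    exact (loop_false hguard (by simp [hxs, hbs]) (hI _ _ _ (.tick s' _) hIs)).mono_time
      (by simp [Expr.cost])
  | of_succ t ht ih =>
    have hbody : Runs W (T + 4) (c ;; x ::= .reg x + 1) (s'.tick 4) fun s'' =>
        s''.reg x = t + 1 ∧ I (t + 1) s'' := by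
      have hIs' : I t (s'.tick 4) := hI _ s' _ (.tick s' 4) hIs
      refine (step t (s'.tick 4) ht hxs (hs.trans (.tick s' 4)) hIs').seq fun s'' hf hI' => ?_
      have hxs'' : s''.reg x = t := (hf.reg x hx).trans hxs
      exact assign (by simp; omega) ⟨by simp [hxs''], hI _ s'' _ .assign hI'⟩ le_rfl
    refine (loop_true hguard (by simp [hxs, hbs, ht]) hbody fun s'' hf hs'' => ?_).mono_time
      (T := 4 + (T + 4) + ((N - (t + 1)) * (T + 8) + 4)) ?_
    · have hbs'' : s''.reg b = N := by
        rw [hf.reg b (by simp [Cmd.footprint, Footprint.append_regs, hb, hxb]), hbs]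
      exact ih (hs.trans hf.append_right) hs''.1 hbs'' hs''.2 (by simp [hs''.1, hbs'']; omega)
    · rw [show N - t = N - (t + 1) + 1 by omega, Nat.succ_mul]
      omega

theorem Runs.forLoop {I : ℕ → State → Prop} {b N : ℕ} (hx : x ∉ c.footprint.regs)
    (hb : b ∉ c.footprint.regs) (hxb : b ≠ x) (hbs : s.reg b = N) (hN : N < W)
    (hI : ∀ t s s', Frame ⟨[x], [], false⟩ s s' → I t s → I t s') (base : I 0 s)
    (step : ∀ t s', t < N → s'.reg x = t → Frame (forLoop x b c).footprint s s' → I t s' →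
      Runs W T c s' (I (t + 1))) :
    Runs W (N * (T + 8) + 6) (forLoop x b c) s (I N) := by
  refine assign_seq (e := 0) (by simp; omega) ?_ (Nat.le_add_left 2 _)
  exact loop_counter hx hb hxb hN hI step N.zero_le Frame.assign.append_left
    (Function.update_self ..) ((Function.update_of_ne hxb ..).trans hbs) (hI _ s _ .assign base)

@[simp] abbrev Reg.size : ℕ := 3
@[simp] abbrev Reg.cell : ℕ := 4
@[simp] abbrev Reg.val : ℕ := 5

/-- For `t = 0, 1, …` below the value of `Reg.size`, store in cell `t` of the array `A` the value
that `c` leaves in `Reg.val`, with `t` in `Reg.cell` while `c` runs. -/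
def tabulate (A : Arr) (c : Cmd) : Cmd :=
  forLoop Reg.cell Reg.size (c ;; .store A (.reg Reg.cell) (.reg Reg.val))

theorem mul_add_lt_mul {m q i j : ℕ} (hi : i < m) (hj : j < q) : i * q + j < m * q :=
  calc i * q + j < (i + 1) * q := by rw [Nat.succ_mul]; omega
    _ ≤ m * q := Nat.mul_le_mul_right _ hi

theorem mul_add_div_eq {q i j : ℕ} (hj : j < q) : (i * q + j) / q = i := by
  rw [add_comm, Nat.add_mul_div_right _ _ (by omega), Nat.div_eq_of_lt hj, zero_add]

theorem mul_add_mod_eq {q i j : ℕ} (hj : j < q) : (i * q + j) % q = j := by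
  rw [Nat.mul_add_mod_self_right, Nat.mod_eq_of_lt hj]

theorem Runs.tabulate {m q : ℕ} {P : ℕ → Fin q → ℕ → Prop} (hcell : Reg.cell ∉ c.footprint.regs)
    (hsize : Reg.size ∉ c.footprint.regs) (hA : A ∉ c.footprint.arrs) (hs : s.reg Reg.size = m * q)
    (hW : m * q < W)
    (step : ∀ i < m, ∀ (j : Fin q) (s' : State), s'.reg Reg.cell = i * q + j →
      Frame (tabulate A c).footprint s s' →
      (∀ i' < i, ∀ j' : Fin q, P i' j' (s'.arr A (i' * q + j'))) →
      Runs W T c s' fun s'' => s''.reg Reg.val < W ∧ P i j (s''.reg Reg.val)) :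
    Runs W (m * q * (T + 11) + 6) (tabulate A c) s
      fun s' => ∀ i < m, ∀ j : Fin q, P i j (s'.arr A (i * q + j)) := by
  let I (t : ℕ) (s' : State) : Prop :=
    ∀ i (j : Fin q), i * q + j < t → P i j (s'.arr A (i * q + j))
  have step' (t : ℕ) (s' : State) (ht : t < m * q) (hcell' : s'.reg Reg.cell = t)
      (hf : Frame (MASRep.tabulate A c).footprint s s') (hI : I t s') :
      Runs W (T + 3) (c ;; .store A (.reg Reg.cell) (.reg Reg.val)) s' (I (t + 1)) := by
    have hq : 0 < q := Nat.pos_of_ne_zero fun h => by simp [h] at ht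
    obtain ⟨i, j, hi, rfl⟩ : ∃ i, ∃ j : Fin q, i < m ∧ t = i * q + j :=
      ⟨t / q, ⟨t % q, Nat.mod_lt _ hq⟩, Nat.div_lt_of_lt_mul (by rwa [mul_comm]),
        (Nat.div_add_mod' t q).symm⟩
    have hrows : ∀ i' < i, ∀ j' : Fin q, P i' j' (s'.arr A (i' * q + j')) := fun i' hi' j' =>
      hI i' j' ((mul_add_lt_mul hi' j'.2).trans_le (Nat.le_add_right _ _))
    refine (step i hi j s' hcell' hf hrows).seq fun s'' hf' hs'' => ?_
    have hcell'' : s''.reg Reg.cell = i * q + j := (hf'.reg _ hcell).trans hcell'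
    refine Runs.store (by simp only [Expr.fits_reg]; omega) hs''.1 fun i' j' hlt => ?_
    by_cases heq : i' * q + j' = i * q + j
    · obtain rfl : i' = i := by
        simpa only [mul_add_div_eq j.2, mul_add_div_eq j'.2] using congrArg (· / q) heq
      obtain rfl : j' = j := Fin.ext (Nat.add_left_cancel heq)
      simpa [hcell''] using hs''.2
    · simpa [hcell'', heq, hf'.arr A hA] using hI i' j' (by omega)
  refine (Runs.forLoop (I := I) (by simpa [Cmd.footprint, Footprint.append_regs] using hcell)
    (by simpa [Cmd.footprint, Footprint.append_regs] using hsize) (by simp) hs hW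
    (fun t s s' hf hI i j hlt => by rw [hf.arr A List.not_mem_nil]; exact hI i j hlt)
    (fun _ _ h => absurd h (by simp)) step').imp
      fun s' _ hI i hi j => hI i j (mul_add_lt_mul hi j.2)

end Programs

/-! ### Construction of the graph -/

section Build

@[simp] abbrev Reg.len : ℕ := 0
@[simp] abbrev Reg.alph : ℕ := 1
@[simp] abbrev Reg.width : ℕ := 2
@[simp] abbrev Reg.letter : ℕ := 6
@[simp] abbrev Reg.fst : ℕ := 7
@[simp] abbrev Reg.snd : ℕ := 8

/-- The table of edges of `StoresGraph`. -/
abbrev edges : Arr := .data 0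

/-- The table of the positions `nextPos w i a`, with the rows in reverse order of `i`. -/
abbrev nexts : Arr := .data 1

variable {σ W : ℕ} {w u : List (Fin σ)} {i j m : ℕ} {a : Fin σ} {D : ℕ → ℕ} {s s' : State}
  {F : Footprint}

theorem code_eq_map : code u = u.map fun a : Fin σ => (a : ℕ) + 1 := by
  rw [code, show (do let a ← u; pure (a : ℕ)) = u.map fun a : Fin σ => (a : ℕ) from
    List.flatMap_pure_eq_map _ u, List.map_map]
  rfl

theorem load_code (hi : i < u.length) : load (m :: code u) (i + 1) = (u[i] : ℕ) + 1 := by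
  simp [load, code_eq_map, List.getD, hi]

theorem inputArray_zero : inputArray w 0 = w.length := rfl

theorem inputArray_one : inputArray w 1 = σ := rfl

theorem inputArray_add_two (hi : i < w.length) : inputArray w (i + 2) = (w[i] : ℕ) + 1 :=
  load_code (m := σ) hi

/-- The input is `w`, the length of `w`, the size of the alphabet and the number of positions
including `0` are in their registers, and the words of the machine are large enough for indices of
the tables. -/
structure Sizes (W : ℕ) (w : List (Fin σ)) (s : State) : Prop where
  alph_le : σ ≤ w.length
  word : (w.length + 1) ^ 3 + 10 < W
  input : s.arr .input = inputArray w
  len : s.reg Reg.len = w.length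
  alph : s.reg Reg.alph = σ
  width : s.reg Reg.width = w.length + 1

namespace Sizes

theorem frame (h : Sizes W w s) (hf : Frame F s s')
    (hF : Reg.len ∉ F.regs ∧ Reg.alph ∉ F.regs ∧ Reg.width ∉ F.regs ∧ .input ∉ F.arrs := by
      decide) :
    Sizes W w s' where
  __ := h
  input := (hf.arr _ hF.2.2.2).trans h.input
  len := (hf.reg _ hF.1).trans h.len
  alph := (hf.reg _ hF.2.1).trans h.alph
  width := (hf.reg _ hF.2.2.1).trans h.width

theorem len_lt (h : Sizes W w s) : w.length + 11 < W := by
  have := h.word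
  have := Nat.le_self_pow (n := 3) (by decide) (w.length + 1)
  omega

theorem table_lt (h : Sizes W w s) : (w.length + 1) * (w.length + 1) * σ + 10 < W :=
  calc (w.length + 1) * (w.length + 1) * σ + 10
    _ ≤ (w.length + 1) * (w.length + 1) * (w.length + 1) + 10 := by
      gcongr; exact h.alph_le.trans (Nat.le_succ _)
    _ < W := by convert h.word using 2; ring

theorem row_lt (h : Sizes W w s) (hi : i ≤ w.length) (a : Fin σ) : i * σ + a + 10 < W := by
  have := h.table_lt
  have := mul_add_lt_mul (show i < (w.length + 1) * (w.length + 1) by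
    have := Nat.le_mul_self (w.length + 1); omega) a.2
  omega

theorem cell_lt (h : Sizes W w s) (hi : i ≤ w.length) (hj : j ≤ w.length) (a : Fin σ) :
    (i * (w.length + 1) + j) * σ + a + 10 < W := by
  have := h.table_lt
  have := mul_add_lt_mul (mul_add_lt_mul (Nat.lt_add_one_of_le hi) (Nat.lt_add_one_of_le hj)) a.2
  omega

end Sizes

/-- Load the parameters that the other programs expect in registers. -/
def setup : Cmd :=
  Reg.len ::= .read .input 0 ;; Reg.alph ::= .read .input 1 ;;
    Reg.width ::= .reg Reg.len + 1

theorem runs_setup (hs : s.arr .input = inputArray w) (hσ : σ ≤ w.length)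
    (hW : (w.length + 1) ^ 3 + 10 < W) : Runs W 10 setup s (Sizes W w) := by
  have := Nat.le_self_pow (n := 3) (by decide) (w.length + 1)
  refine Runs.assign_seq ?_ (Runs.assign_seq ?_ (Runs.assign ?_ ⟨hσ, hW, ?_, ?_, ?_, ?_⟩))
  all_goals simp [hs, inputArray_zero, inputArray_one]
  all_goals omega

/-- Compute an entry of the table `nexts`. Its row `n - i` is about the position `i`, so that each
row follows from the previous one. -/
def nextEntry : Cmd :=
  Reg.letter ::= .reg Reg.cell % .reg Reg.alph ;;
  Reg.fst ::= .reg Reg.len - .reg Reg.cell / .reg Reg.alph ;;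
  .cond (.reg Reg.fst =ₑ .reg Reg.len) (Reg.val ::= .reg Reg.width)
    (.cond (.read .input (.reg Reg.fst + 2) =ₑ .reg Reg.letter + 1) (Reg.val ::= .reg Reg.fst + 1)
      (Reg.val ::= .read nexts (.reg Reg.cell - .reg Reg.alph)))

theorem runs_nextEntry (h : Sizes W w s) (hi : i ≤ w.length)
    (hcell : s.reg Reg.cell = (w.length - i) * σ + a)
    (hnext : i < w.length → s.arr nexts ((w.length - (i + 1)) * σ + a) = nextPos w (i + 1) a) :
    Runs W 40 nextEntry s fun s' => s'.reg Reg.val = nextPos w i a := by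
  have hrow := h.row_lt (Nat.sub_le w.length i) a
  have hdiv := mul_add_div_eq (i := w.length - i) a.2
  have hmod := mul_add_mod_eq (i := w.length - i) a.2
  have hlen_lt := h.len_lt
  obtain ⟨hσ, -, hin, hlen, halph, hwidth⟩ := h
  refine Runs.assign_seq ?_ (Runs.assign_seq ?_ (Runs.cond (p := i = w.length) ?_ ?_
    (fun hlast => Runs.assign ?_ ?_) fun hlast => ?_))
  · simp [hcell, halph]; omega
  · simp [hcell, halph, hlen]; omega
  · simp [hlen, hcell, halph, hdiv]; omega
  · simp [hlen, hcell, halph, hdiv]; omega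
  · simp [hwidth]; omega
  · simp [hwidth, hlast, nextPos_length]
  replace hi : i < w.length := by omega
  have hsub : w.length - (w.length - i) = i := by omega
  have hprev : (w.length - i) * σ + a - σ = (w.length - (i + 1)) * σ + a := by
    rw [show w.length - i = w.length - (i + 1) + 1 by omega, Nat.succ_mul]; omega
  have hpos := nextPos_eq_ite (a := a) hi
  refine Runs.cond (p := w[i] = a) ?_ ?_ (fun hletter => Runs.assign ?_ ?_)
    fun hletter => Runs.assign ?_ ?_
  · simp [hcell, halph, hlen, hmod, hdiv, hsub, hin, inputArray_add_two hi]; omega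
  · simp [hcell, halph, hlen, hmod, hdiv, hsub, hin, inputArray_add_two hi, Fin.ext_iff]
  · simp [hcell, halph, hlen, hdiv, hsub]; omega
  · simp [hcell, halph, hlen, hdiv, hsub, hpos, hletter]
  · have hle : nextPos w (i + 1) a ≤ w.length + 1 := nextPos_le hi
    have hnext := hnext hi
    simp [hcell, halph, hprev]
    omega
  · simp [hcell, halph, hprev, hnext hi, hpos, hletter]

/-- Fill the table `nexts`. -/
def fillNext : Cmd :=
  Reg.size ::= .reg Reg.width * .reg Reg.alph ;; tabulate nexts nextEntry

theorem runs_fillNext (h : Sizes W w s) :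
    Runs W ((w.length + 1) * σ * 51 + 10) fillNext s fun s' => Sizes W w s' ∧
      ∀ i ≤ w.length, ∀ a : Fin σ, s'.arr nexts ((w.length - i) * σ + a) = nextPos w i a := by
  have hsize_lt : (w.length + 1) * σ < W :=
    (Nat.mul_le_mul_right σ (Nat.le_mul_self (w.length + 1))).trans_lt
      ((Nat.le_add_right _ 10).trans_lt h.table_lt)
  have hlen_lt := h.len_lt
  have hσ := h.alph_le
  refine ((Runs.assign (T := 4) (Q := fun s' => s'.reg Reg.size = (w.length + 1) * σ)
    (by simp [h.width, h.alph]; omega) (by simp [h.width, h.alph])).seq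
      fun s' hf hsize => ?_).mono_time (Nat.add_comm 4 _).le
  replace h := h.frame hf
  refine (Runs.tabulate (m := w.length + 1) (q := σ) (T := 40)
    (P := fun r a v => v = nextPos w (w.length - r) a) (by decide) (by decide) (by decide)
    hsize hsize_lt fun r hr a s' hcell hf hrows => ?_).imp
      fun s' hf hP => ⟨h.frame hf, fun i hi a => ?_⟩
  · have hrow : w.length - (w.length - r) = r := by omega
    refine (runs_nextEntry (h.frame hf) (Nat.sub_le _ _) (by rwa [hrow]) fun hlt => ?_).imp
      fun s'' _ hval => ⟨?_, hval⟩
    · have hprev := hrows (w.length - (w.length - r + 1)) (by omega) a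
      rwa [show w.length - (w.length - (w.length - r + 1)) = w.length - r + 1 by omega] at hprev
    · have hle : nextPos w (w.length - r) a ≤ w.length + 1 := nextPos_le (Nat.sub_le _ _)
      omega
  · simpa only [Nat.sub_sub_self hi] using hP (w.length - i) (by omega) a

/-- Compute an entry of the table `edges` by two lookups in the table `nexts`. -/
def edgeEntry : Cmd :=
  Reg.letter ::= .reg Reg.cell % .reg Reg.alph ;;
  Reg.fst ::= .reg Reg.cell / .reg Reg.alph / .reg Reg.width ;;
  Reg.snd ::= .reg Reg.cell / .reg Reg.alph % .reg Reg.width ;;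
  .cond ((.reg Reg.fst =ₑ 0) + (.read nexts ((.reg Reg.len - .reg Reg.snd) * .reg Reg.alph +
      .reg Reg.letter) <ₑ .reg Reg.fst + 1))
    (Reg.val ::= .read nexts ((.reg Reg.len - .reg Reg.fst) * .reg Reg.alph + .reg Reg.letter))
    (Reg.val ::= 0)

theorem runs_edgeEntry (h : Sizes W w s) (hi : i ≤ w.length) (hj : j ≤ w.length)
    (hcell : s.reg Reg.cell = (i * (w.length + 1) + j) * σ + a)
    (hnext : ∀ i ≤ w.length, ∀ a : Fin σ, s.arr nexts ((w.length - i) * σ + a) = nextPos w i a) :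
    Runs W 60 edgeEntry s fun s' => s'.reg Reg.val = target w i j a := by
  have hcell_lt := h.cell_lt hi hj a
  have hdiv := mul_add_div_eq (i := i * (w.length + 1) + j) a.2
  have hmod := mul_add_mod_eq (i := i * (w.length + 1) + j) a.2
  have hdiv' : (i * (w.length + 1) + j) / (w.length + 1) = i :=
    mul_add_div_eq (Nat.lt_add_one_of_le hj)
  have hmod' : (i * (w.length + 1) + j) % (w.length + 1) = j :=
    mul_add_mod_eq (Nat.lt_add_one_of_le hj)
  have hrow_i := h.row_lt (Nat.sub_le w.length i) a
  have hrow_j := h.row_lt (Nat.sub_le w.length j) a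
  have hi_le : nextPos w i a ≤ w.length + 1 := nextPos_le hi
  have hj_le : nextPos w j a ≤ w.length + 1 := nextPos_le hj
  have hlen_lt := h.len_lt
  obtain ⟨hσ, -, -, hlen, halph, hwidth⟩ := h
  refine Runs.assign_seq ?_ (Runs.assign_seq ?_ (Runs.assign_seq ?_ (Runs.cond
    (p := i = 0 ∨ nextPos w j a ≤ i) ?_ ?_ (fun henabled => Runs.assign ?_ ?_)
      fun henabled => Runs.assign ?_ ?_)))
  · simp [hcell, halph]; omega
  · simp [hcell, halph, hwidth]; omega
  · simp [hcell, halph, hwidth]; omega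
  · simp [hcell, halph, hwidth, hlen, hdiv, hmod, hdiv', hmod', hnext j hj]; split_ifs <;> omega
  · simp [hcell, halph, hwidth, hlen, hdiv, hmod, hdiv', hmod', hnext j hj]; omega
  · simp [hcell, halph, hwidth, hlen, hdiv, hmod, hdiv', hnext i hi]; omega
  · simp [hcell, halph, hwidth, hlen, hdiv, hmod, hdiv', hnext i hi,
      target_of_enabled henabled]
  · simp; omega
  · simp [target_of_not_enabled henabled]

/-- `D` holds `target w i j a` in the cell of the `(n+1) × (n+1) × σ` array with the indices `i`,
`j`, `a`, also when `(i, j)` is not a node. -/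
def IsTable (w : List (Fin σ)) (D : ℕ → ℕ) : Prop :=
  ∀ i ≤ w.length, ∀ j ≤ w.length, ∀ a : Fin σ,
    D ((i * (w.length + 1) + j) * σ + a) = target w i j a

theorem IsTable.storesGraph (h : IsTable w D) : StoresGraph w D := by
  intro i j a hp
  rw [h i hp.fst_le j hp.snd_le a]
  have hle : target w i j a ≤ w.length + 1 := target_le hp.fst_le
  refine ⟨hle, fun k hk hkn => ?_, ?_⟩ <;>
    simp only [edge_iff hp, Node.pos.injEq, reduceCtorEq, and_false, and_true, or_false, false_or]
  omega

/-- Fill the table `edges`, from the table `nexts`. -/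
def fillTable : Cmd :=
  Reg.size ::= .reg Reg.width * .reg Reg.width * .reg Reg.alph ;; tabulate edges edgeEntry

theorem runs_fillTable (h : Sizes W w s)
    (hnext : ∀ i ≤ w.length, ∀ a : Fin σ, s.arr nexts ((w.length - i) * σ + a) = nextPos w i a) :
    Runs W ((w.length + 1) * (w.length + 1) * σ * 71 + 12) fillTable s fun s' =>
      Sizes W w s' ∧ IsTable w (s'.arr edges) := by
  have hsize_lt := h.table_lt
  have hlen_lt := h.len_lt
  have hσ := h.alph_le
  have hsq_lt : (w.length + 1) * (w.length + 1) < W := by have := h.word; nlinarith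
  refine ((Runs.assign (T := 6)
    (Q := fun s' => s'.reg Reg.size = (w.length + 1) * (w.length + 1) * σ)
    (by simp [h.width, h.alph]; omega) (by simp [h.width, h.alph])).seq
      fun s' hf hsize => ?_).mono_time (Nat.add_comm 6 _).le
  replace h := h.frame hf
  rw [← hf.arr nexts (by decide)] at hnext
  refine (Runs.tabulate (m := (w.length + 1) * (w.length + 1)) (q := σ) (T := 60)
    (P := fun r a v => v = target w (r / (w.length + 1)) (r % (w.length + 1)) a)
    (by decide) (by decide) (by decide) hsize (by omega) fun r hr a s' hcell hf _ => ?_).imp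
      fun s' hf hP => ⟨h.frame hf, fun i hi j hj a => ?_⟩
  · have hi : r / (w.length + 1) ≤ w.length := Nat.lt_succ_iff.1 (Nat.div_lt_of_lt_mul hr)
    have hj : r % (w.length + 1) ≤ w.length := Nat.lt_succ_iff.1 (Nat.mod_lt r (Nat.succ_pos _))
    refine (runs_edgeEntry (h.frame hf) hi hj (by rwa [Nat.div_add_mod'])
      (by rwa [hf.arr nexts (by decide)])).imp fun s'' _ hval => ⟨?_, hval⟩
    have hle : target w (r / (w.length + 1)) (r % (w.length + 1)) a ≤ w.length + 1 := target_le hi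
    omega
  · have hcell := mul_add_lt_mul (Nat.lt_add_one_of_le hi) (Nat.lt_add_one_of_le hj)
    have hdiv := mul_add_div_eq (i := i) (Nat.lt_add_one_of_le hj)
    have hmod := mul_add_mod_eq (i := i) (Nat.lt_add_one_of_le hj)
    simpa only [hdiv, hmod] using hP _ hcell a

/-- The parameters are in their registers, and the array `edges` stores the graph of `w`. -/
structure Ready (W : ℕ) (w : List (Fin σ)) (s : State) : Prop extends Sizes W w s where
  table : IsTable w (s.arr edges)

theorem Ready.frame (h : Ready W w s) (hf : Frame F s s')
    (hF : (Reg.len ∉ F.regs ∧ Reg.alph ∉ F.regs ∧ Reg.width ∉ F.regs ∧ .input ∉ F.arrs) ∧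
      edges ∉ F.arrs := by decide) : Ready W w s' where
  __ := h.toSizes.frame hf hF.1
  table := by rw [hf.arr edges hF.2]; exact h.table

/-- Construct the graph, as the table `edges`. -/
def build : Cmd := setup ;; fillNext ;; fillTable

theorem runs_build (hσ₁ : 1 ≤ σ) (hσ : σ ≤ w.length) (hW : (w.length + 1) ^ 3 + 10 < W) :
    Runs W (500 * (w.length ^ 2 * σ)) build (initial w) (Ready W w) := by
  refine ((runs_setup rfl hσ hW).seq fun s' _ h => (runs_fillNext h).seq fun s'' _ h' =>
    (runs_fillTable h'.1 h'.2).imp fun _ _ h'' => ⟨h''.1, h''.2⟩).mono_time ?_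
  obtain ⟨n, hn⟩ : ∃ n, w.length = n + 1 := Nat.exists_eq_add_of_le' (hσ₁.trans hσ)
  obtain ⟨q, rfl⟩ := Nat.exists_eq_add_of_le' hσ₁
  rw [hn]; ring_nf; nlinarith

theorem runs_setup_of_isQueryStart {s₁ : State} (h : Ready W w s₁) (hs : IsQueryStart s₁ s) :
    Runs W 10 setup s (Ready W w) :=
  (runs_setup (hs.1.1.trans h.input) h.alph_le h.word).imp fun s' hf h' =>
    { h' with table := by rw [hf.arr edges (by decide), hs.1.2 0]; exact h.table }

/-- The entry of the table for the node and the letter in the registers. -/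
def edge : Expr :=
  .read edges ((.reg Reg.fst * .reg Reg.width + .reg Reg.snd) * .reg Reg.alph + .reg Reg.letter)

theorem Ready.val_edge (h : Ready W w s) (hi : i ≤ w.length) (hj : j ≤ w.length)
    (hfst : s.reg Reg.fst = i) (hsnd : s.reg Reg.snd = j) (hletter : s.reg Reg.letter = a) :
    edge.val s = target w i j a := by
  simpa [edge, hfst, hsnd, hletter, h.width, h.alph] using h.table i hi j hj a

theorem Ready.fits_edge (h : Ready W w s) (hi : i ≤ w.length) (hj : j ≤ w.length)
    (hfst : s.reg Reg.fst = i) (hsnd : s.reg Reg.snd = j) (hletter : s.reg Reg.letter = a) :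
    edge.Fits W s := by
  have hval := h.val_edge hi hj hfst hsnd hletter
  have hle : target w i j a ≤ w.length + 1 := target_le hi
  have hcell_lt := h.cell_lt hi hj a
  have hlen_lt := h.len_lt
  have hσ := h.alph_le
  have hrow : i * (w.length + 1) + j ≤ (i * (w.length + 1) + j) * σ :=
    Nat.le_mul_of_pos_right _ a.pos
  have hwidth := h.width
  have halph := h.alph
  refine ⟨?_, hval.trans_lt (by omega)⟩
  simp [hfst, hsnd, hletter, hwidth, halph]; omega

end Build

/-! ### Checking a given word -/

section Check

variable {σ W T : ℕ} {w u : List (Fin σ)} {i j : ℕ} {a : Fin σ} {s : State} {c : Cmd} {e : Expr}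
  {Q : State → Prop}

theorem Exec.sameData {s' : State} (h : Exec W c s s')
    (hc : (c.footprint.arrs.all fun A => A matches .work _) = true := by decide) :
    SameData s s' := by
  have hkeep (A : Arr) (hA : ∀ k, A ≠ .work k) : s'.arr A = s.arr A :=
    h.frame.arr A fun hmem => by
      have := List.all_eq_true.1 hc A hmem
      cases A <;> simp_all
  exact ⟨hkeep _ (by simp), fun k => hkeep _ (by simp)⟩

theorem Runs.answers {s₁ : State} {T' : ℕ} (h : Runs W T c s Q) (hs : IsQueryStart s₁ s)
    (hT : T ≤ T') (hc : (c.footprint.arrs.all fun A => A matches .work _) = true := by decide) :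
    Answers W c s fun s' => s'.clock ≤ T' ∧ Q s' := by
  obtain ⟨s', hexec, htime, hQ⟩ := h
  have hclock := hs.2.1
  exact ⟨s', hexec, hexec.sameData hc, by omega, hQ⟩

theorem Runs.output_decides {p : Prop} [Decidable p] (he : e.Fits W s) (hs : s.out = [])
    (h : e.val s = if p then 1 else 0) (hT : e.cost + 1 ≤ T := by decide) :
    Runs W T (.output e) s fun s' => s'.Decides p :=
  Runs.output he (by by_cases hp : p <;> simp [State.Decides, State.written, hs, h, hp]) hT

/-- The state `(i, j)` of the automaton that reads labels along a path accepts `u`. Here `i ≤ n`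
stands for the node `(i, j)`, `i = n + 1` for the sink, and a larger `i` for failure. -/
def Accepts (w : List (Fin σ)) (i j : ℕ) (u : List (Fin σ)) : Prop :=
  if i ≤ w.length then Completes w i j u else i = w.length + 1 ∧ u = []

theorem accepts_zero : Accepts w 0 j u ↔ IsMAS w u := by
  rw [Accepts, if_pos (Nat.zero_le _), completes_zero]

theorem accepts_nil : Accepts w i j [] ↔ i = w.length + 1 := by
  unfold Accepts
  split_ifs <;> simp only [not_completes_nil, and_true, false_iff]; omega

theorem not_accepts_of_lt (hi : w.length + 1 < i) : ¬ Accepts w i j u := by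
  rw [Accepts, if_neg (by omega)]; omega

theorem accepts_cons_iff (hj : j ≤ w.length) : Accepts w i j (a :: u) ↔
    i ≤ w.length ∧ target w i j a ≠ 0 ∧ Accepts w (target w i j a) i u := by
  by_cases hi : i ≤ w.length
  · have hle : target w i j a ≤ w.length + 1 := target_le hi
    simp only [Accepts, hi, if_true, completes_cons_iff hi hj, true_and]
    split_ifs with hk
    · simp only [hk, true_and, or_iff_right_iff_imp, and_imp]; omega
    · simp only [hk, false_and, and_false, or_false]
      exact ⟨fun h => ⟨by omega, h⟩, And.right⟩
  · simp only [Accepts, hi, if_false, reduceCtorEq, and_false, false_and]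

/-- One transition of the automaton, with the state in `Reg.fst` and `Reg.snd`. -/
def readLetter : Cmd :=
  .cond (.reg Reg.fst <ₑ .reg Reg.width)
    (Reg.val ::= edge ;; Reg.snd ::= .reg Reg.fst ;;
      .cond (.reg Reg.val) (Reg.fst ::= .reg Reg.val) (Reg.fst ::= .reg Reg.width + 1))
    (Reg.fst ::= .reg Reg.width + 1)

theorem runs_readLetter (h : Ready W w s) (hi : i ≤ w.length + 2) (hj : j ≤ w.length)
    (hfst : s.reg Reg.fst = i) (hsnd : s.reg Reg.snd = j) (hletter : s.reg Reg.letter = a) :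
    Runs W 30 readLetter s fun s' => s'.reg Reg.fst ≤ w.length + 2 ∧ s'.reg Reg.snd ≤ w.length ∧
      ∀ u, Accepts w i j (a :: u) ↔ Accepts w (s'.reg Reg.fst) (s'.reg Reg.snd) u := by
  have hlen_lt := h.len_lt
  have hwidth := h.width
  have hfail (j u) : ¬ Accepts w (w.length + 2) j u := not_accepts_of_lt (by omega)
  refine Runs.cond (p := i ≤ w.length) (by simp [hwidth, hfst]; omega)
    (by simp [hwidth, hfst]) (fun hi => ?_) fun hi => Runs.assign ?_ ?_
  · have hle : target w i j a ≤ w.length + 1 := target_le hi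
    have hval := h.val_edge hi hj hfst hsnd hletter
    refine Runs.assign_seq (Expr.fits_tick.2 (h.fits_edge hi hj hfst hsnd hletter))
      (Runs.assign_seq ?_ (Runs.cond (p := target w i j a ≠ 0) ?_ ?_
        (fun htarget => Runs.assign ?_ ?_) fun htarget => Runs.assign ?_ ?_))
    · simp [hfst]; omega
    · simp [hval]; omega
    · simp [hval]
    · simp [hval]; omega
    · simp [hval, hfst, accepts_cons_iff hj, hi, htarget]; omega
    · simp [hwidth]; omega
    · simp [hwidth, hfst, accepts_cons_iff hj, hi, htarget, hfail]
  · simp [hwidth]; omega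
  · simp [hwidth, hsnd, hj, accepts_cons_iff hj, hi, hfail]

/-- Run the automaton on the word in the query, whose length is in `Reg.size`. -/
def readWord : Cmd :=
  forLoop Reg.cell Reg.size (Reg.letter ::= .read .query (.reg Reg.cell + 1) - 1 ;; readLetter)

theorem runs_readWord (h : Ready W w s) (hu : u.length < W)
    (hq : s.arr .query = load (u.length :: code u)) (hsize : s.reg Reg.size = u.length)
    (hfst : s.reg Reg.fst = 0) (hsnd : s.reg Reg.snd = 0) :
    Runs W (u.length * 45 + 6) readWord s fun s' =>
      s'.reg Reg.fst ≤ w.length + 2 ∧ (IsMAS w u ↔ s'.reg Reg.fst = w.length + 1) := by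
  let I (t : ℕ) (s' : State) : Prop :=
    s'.reg Reg.fst ≤ w.length + 2 ∧ s'.reg Reg.snd ≤ w.length ∧
      (IsMAS w u ↔ Accepts w (s'.reg Reg.fst) (s'.reg Reg.snd) (u.drop t))
  have hlen_lt := h.len_lt
  have hσ := h.alph_le
  refine (Runs.forLoop (I := I) (T := 37) (by decide) (by decide) (by decide) hsize hu
    (fun t s s' hf hI => ?_) ?_ fun t s' ht hcell hf hI => ?_).imp fun s' _ hI => ?_
  · simpa only [I, hf.reg Reg.fst (by decide), hf.reg Reg.snd (by decide)] using hI
  · simp [I, hfst, hsnd, accepts_zero]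
  · have hread : s'.arr .query (t + 1) = (u[t] : ℕ) + 1 := by
      rw [hf.arr .query (by decide), hq, load_code ht]
    have := u[t].2
    refine (Runs.assign (T := 7) (Q := fun s' => s'.reg Reg.letter = u[t]) ?_ ?_).seq
      fun s₁ hf₁ hletter => (runs_readLetter ((h.frame hf).frame hf₁) hI.1 hI.2.1
        (hf₁.reg Reg.fst (by decide)) (hf₁.reg Reg.snd (by decide)) hletter).imp
      fun s₂ _ h₂ => ⟨h₂.1, h₂.2.1, hI.2.2.trans ?_⟩
    · simp [hcell, hread]; omega
    · simp [hcell, hread]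
    · rw [List.drop_eq_getElem_cons ht]
      exact h₂.2.2 _
  · refine ⟨hI.1, hI.2.2.trans ?_⟩
    rw [List.drop_length, accepts_nil]

/-- Decide whether the word in the query is a minimal absent subsequence, by running the
automaton on it. -/
def check : Cmd :=
  setup ;; (Reg.size ::= .read .query 0 ;; Reg.fst ::= 0 ;; Reg.snd ::= 0) ;; readWord ;;
  .output (.reg Reg.fst =ₑ .reg Reg.width)

theorem answers_check {s₁ : State} (h : Ready W w s₁) (hs : IsQueryStart s₁ s)
    (hu : u.length < W) (hq : s.arr .query = load (u.length :: code u)) :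
    Answers W check s fun s' => s'.clock ≤ 100 * (u.length + 1) ∧ s'.Decides (IsMAS w u) := by
  classical
  have hruns : Runs W (10 + (7 + ((u.length * 45 + 6) + 4))) check s
      fun s' => s'.Decides (IsMAS w u) := by
    refine (runs_setup_of_isQueryStart h hs).seq fun s₂ hf h => ?_
    have hlen_lt := h.len_lt
    replace hq : s₂.arr .query = load (u.length :: code u) := by rw [hf.arr .query (by decide), hq]
    have hread : s₂.arr .query 0 = u.length := by rw [hq]; rfl
    refine Runs.seq (P := fun s' => s'.reg Reg.size = u.length ∧ s'.reg Reg.fst = 0 ∧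
      s'.reg Reg.snd = 0) (Runs.assign_seq ?_ (Runs.assign_seq ?_ (Runs.assign ?_ ?_)))
      fun s₃ hf₃ h₃ => (runs_readWord (h.frame hf₃) hu (by rw [hf₃.arr .query (by decide), hq])
        h₃.1 h₃.2.1 h₃.2.2).seq fun s₄ hf₄ h₄ => Runs.output_decides ?_ ?_ ?_
    · simp [hread]; omega
    · simp; omega
    · simp; omega
    · simp [hread]
    · have hwidth := ((h.frame hf₃).frame hf₄).width
      have hfst_le := h₄.1
      simp only [Reg.fst, Reg.width] at hwidth hfst_le
      simp [hwidth]; omega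
    · rw [hf₄.out rfl, hf₃.out rfl, hf.out rfl, hs.2.2]
    · simp [((h.frame hf₃).frame hf₄).width, h₄.2]
  exact hruns.answers hs (by omega)

end Check

/-! ### Lengths of completions -/

section Lengths

@[simp] abbrev Reg.row : ℕ := 9
@[simp] abbrev Reg.next : ℕ := 10

/-- The table of `IsLengthTable`. It is rebuilt by each query that needs it. -/
abbrev lengths : Arr := .work 0

variable {σ W t i j k b v : ℕ} {w u : List (Fin σ)} {a : Fin σ} {s : State} {L : ℕ → ℕ}

/-- From `(i, j)`, a path of length `t + 1` to the sink starts with the letter `a`. -/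
def Leads (w : List (Fin σ)) (t i j : ℕ) (a : Fin σ) : Prop :=
  target w i j a ≠ 0 ∧ ∃ u, u.length = t ∧ Accepts w (target w i j a) i u

theorem leads_zero_iff : Leads w 0 i j a ↔ target w i j a = w.length + 1 := by
  simp only [Leads, List.length_eq_zero_iff, exists_eq_left, accepts_nil, and_iff_right_iff_imp]
  omega

theorem exists_leads_iff (hi : i ≤ w.length) (hj : j ≤ w.length) :
    (∃ a, Leads w t i j a) ↔ ∃ u, u.length = t + 1 ∧ Accepts w i j u := by
  constructor
  · rintro ⟨a, htarget, u, hlen, hu⟩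
    exact ⟨a :: u, congrArg (· + 1) hlen, (accepts_cons_iff hj).2 ⟨hi, htarget, hu⟩⟩
  · rintro ⟨v, hlen, hv⟩
    obtain ⟨a, u, rfl⟩ := List.exists_cons_of_length_eq_add_one hlen
    obtain ⟨-, htarget, hu⟩ := (accepts_cons_iff hj).1 hv
    exact ⟨a, htarget, u, Nat.succ.inj hlen, hu⟩

theorem leads_succ_iff (hi : i ≤ w.length) : Leads w (t + 1) i j a ↔
    target w i j a ≠ 0 ∧ target w i j a ≤ w.length ∧ ∃ b, Leads w t (target w i j a) i b := by
  refine and_congr_right fun _ => ⟨?_, fun ⟨hle, h⟩ => (exists_leads_iff hle hi).1 h⟩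
  rintro ⟨u, hlen, hu⟩
  obtain ⟨b, u, rfl⟩ := List.exists_cons_of_length_eq_add_one hlen
  have hle := ((accepts_cons_iff hi).1 hu).1
  exact ⟨hle, (exists_leads_iff hle hi).2 ⟨b :: u, hlen, hu⟩⟩

/-- `v` is the code of a letter below `b` that satisfies `p`, or `0` if there is no such letter. -/
def IsWitness (p : Fin σ → Prop) (b v : ℕ) : Prop :=
  v ≤ b ∧ (v = 0 → ∀ a : Fin σ, a < b → ¬ p a) ∧ ∀ a : Fin σ, v = a + 1 → p a

namespace IsWitness

variable {p : Fin σ → Prop}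

theorem zero : IsWitness p 0 0 :=
  ⟨le_rfl, fun _ _ h => absurd h (Nat.not_lt_zero _), fun _ h => absurd h (Nat.succ_ne_zero _).symm⟩

theorem succ (h : p a) : IsWitness p (a + 1) (a + 1) :=
  ⟨le_rfl, fun h => absurd h (Nat.succ_ne_zero _), fun b hb => by
    rwa [← Fin.ext (Nat.succ.inj hb)]⟩

theorem mono (hv : IsWitness p a v) (h : ¬ p a) : IsWitness p (a + 1) v := by
  refine ⟨hv.1.trans (Nat.le_succ _), fun hv₀ b hb => ?_, hv.2.2⟩
  obtain hlt | heq := Nat.lt_succ_iff_lt_or_eq.1 hb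
  · exact hv.2.1 hv₀ b hlt
  · rwa [Fin.ext heq]

theorem exists_eq (h : IsWitness p σ v) (hp : ∃ a, p a) : ∃ a : Fin σ, v = a + 1 ∧ p a := by
  obtain ⟨b, hb⟩ := hp
  have hv : v ≠ 0 := fun hv => h.2.1 hv b b.2 hb
  have heq : v = v - 1 + 1 := by omega
  exact ⟨⟨v - 1, by have := h.1; omega⟩, heq, h.2.2 _ heq⟩

theorem ne_zero_iff (h : IsWitness p σ v) : v ≠ 0 ↔ ∃ a, p a := by
  refine ⟨fun hv => ⟨⟨v - 1, by have := h.1; omega⟩, h.2.2 _ (by simp only; omega)⟩, fun hp => ?_⟩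
  obtain ⟨a, rfl, -⟩ := h.exists_eq hp
  exact Nat.succ_ne_zero _

end IsWitness

theorem Sizes.length_lt (h : Sizes W w s) (ht : t ≤ w.length) (hi : i ≤ w.length)
    (hj : j ≤ w.length) : (t * (w.length + 1) + i) * (w.length + 1) + j + 10 < W := by
  have hrow := mul_add_lt_mul (Nat.lt_add_one_of_le ht) (Nat.lt_add_one_of_le hi)
  have hcell := mul_add_lt_mul hrow (Nat.lt_add_one_of_le hj)
  calc _ < (w.length + 1) * (w.length + 1) * (w.length + 1) + 10 := Nat.add_lt_add_right hcell 10
    _ < W := by convert h.word using 2; ring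

/-- Decide whether the letter in `Reg.letter` starts a path of length `t + 1` from `(i, j)` to the
sink, with `t`, `i`, `j` in `Reg.row`, `Reg.fst`, `Reg.snd`. -/
def testLetter : Cmd :=
  Reg.next ::= edge ;;
  .cond (.reg Reg.row)
    (.cond ((0 <ₑ .reg Reg.next) * (.reg Reg.next <ₑ .reg Reg.width))
      (Reg.next ::= .read lengths (((.reg Reg.row - 1) * .reg Reg.width + .reg Reg.next) *
        .reg Reg.width + .reg Reg.fst))
      (Reg.next ::= 0))
    (Reg.next ::= .reg Reg.next =ₑ .reg Reg.width)

theorem runs_testLetter (h : Ready W w s) (ht : t ≤ w.length) (hi : i ≤ w.length)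
    (hj : j ≤ w.length) (hrow : s.reg Reg.row = t) (hfst : s.reg Reg.fst = i)
    (hsnd : s.reg Reg.snd = j) (hletter : s.reg Reg.letter = a)
    (hprev : ∀ t' k, t = t' + 1 → k ≤ w.length → IsWitness (Leads w t' k i) σ
      (s.arr lengths ((t' * (w.length + 1) + k) * (w.length + 1) + i))) :
    Runs W 40 testLetter s fun s' => s'.reg Reg.next < W ∧
      (s'.reg Reg.next ≠ 0 ↔ Leads w t i j a) := by
  have hlen_lt := h.len_lt
  have hσ := h.alph_le
  have hwidth := h.width
  have hval := h.val_edge hi hj hfst hsnd hletter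
  have hle : target w i j a ≤ w.length + 1 := target_le hi
  refine Runs.assign_seq (h.fits_edge hi hj hfst hsnd hletter) (Runs.cond (p := t ≠ 0) ?_ ?_
    (fun ht₀ => ?_) fun ht₀ => Runs.assign ?_ ?_)
  · simp [hrow]; omega
  · simp [hrow]
  · obtain ⟨t, rfl⟩ := Nat.exists_eq_add_one_of_ne_zero ht₀
    refine Runs.cond (p := target w i j a ≠ 0 ∧ target w i j a ≤ w.length) ?_ ?_
      (fun htarget => Runs.assign ?_ ?_) fun htarget => Runs.assign ?_ ?_
    · simp [hwidth, hval]; split_ifs <;> omega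
    · simp [hwidth, hval]; omega
    · have hcell_lt := h.length_lt (t := t) (by omega) htarget.2 hi
      have hmul : t * (w.length + 1) + target w i j a ≤
        (t * (w.length + 1) + target w i j a) * (w.length + 1) :=
        Nat.le_mul_of_pos_right _ (by omega)
      have hentry_le := (hprev t _ rfl htarget.2).1
      simp [hwidth, hval, hrow, hfst]; omega
    · have hwitness := hprev t _ rfl htarget.2
      have hentry_le := hwitness.1
      have hiff := hwitness.ne_zero_iff
      refine ⟨?_, by simpa [hwidth, hval, hrow, hfst, leads_succ_iff hi, htarget] using hiff⟩
      simp [hwidth, hval, hrow, hfst]; omega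
    · simp; omega
    · refine ⟨by simp; omega, ?_⟩
      simpa [leads_succ_iff hi] using fun h₁ h₂ => absurd ⟨h₁, h₂⟩ htarget
  · simp [hwidth, hval]; omega
  · rw [not_not.1 ht₀, leads_zero_iff]
    simp [hwidth, hval]; split_ifs <;> omega

/-- Compute an entry of the table `lengths` by testing all letters. -/
def lengthEntry : Cmd :=
  (Reg.row ::= .reg Reg.cell / .reg Reg.width / .reg Reg.width ;;
    Reg.fst ::= .reg Reg.cell / .reg Reg.width % .reg Reg.width ;;
    Reg.snd ::= .reg Reg.cell % .reg Reg.width ;; Reg.val ::= 0) ;;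
  forLoop Reg.letter Reg.alph
    (testLetter ;; .cond (.reg Reg.next) (Reg.val ::= .reg Reg.letter + 1) .skip)

theorem runs_lengthEntry (h : Ready W w s) (ht : t ≤ w.length) (hi : i ≤ w.length)
    (hj : j ≤ w.length) (hcell : s.reg Reg.cell = (t * (w.length + 1) + i) * (w.length + 1) + j)
    (hprev : ∀ t' k, t = t' + 1 → k ≤ w.length → IsWitness (Leads w t' k i) σ
      (s.arr lengths ((t' * (w.length + 1) + k) * (w.length + 1) + i))) :
    Runs W (σ * 60 + 40) lengthEntry s fun s' => IsWitness (Leads w t i j) σ (s'.reg Reg.val) := by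
  have hlen_lt := h.len_lt
  have hσ := h.alph_le
  have hcell_lt := h.length_lt ht hi hj
  have hdiv := mul_add_div_eq (i := t * (w.length + 1) + i) (Nat.lt_add_one_of_le hj)
  have hmod := mul_add_mod_eq (i := t * (w.length + 1) + i) (Nat.lt_add_one_of_le hj)
  have hdiv' := mul_add_div_eq (i := t) (Nat.lt_add_one_of_le hi)
  have hmod' := mul_add_mod_eq (i := t) (Nat.lt_add_one_of_le hi)
  have hwidth := h.width
  refine ((Runs.seq (T₁ := 18) (P := fun s' => s'.reg Reg.row = t ∧ s'.reg Reg.fst = i ∧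
    s'.reg Reg.snd = j ∧ s'.reg Reg.val = 0) (Runs.assign_seq ?_ (Runs.assign_seq ?_
      (Runs.assign_seq ?_ (Runs.assign ?_ ?_)))) fun s₁ hf₁ h₁ =>
        Runs.forLoop (I := fun b s' => IsWitness (Leads w t i j) b (s'.reg Reg.val)) (T := 50)
          (by decide) (by decide) (by decide) ((h.frame hf₁).alph) (by omega)
          (fun b s s' hf hI => ?_) ?_ fun b s₂ hb hletter hf hI => ?_)).mono_time (by omega)
  · simp [hcell, hwidth]; omega
  · simp [hcell, hwidth]; omega
  · simp [hcell, hwidth]; omega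
  · simp; omega
  · simp [hcell, hwidth, hdiv, hmod, hdiv', hmod']
  · simpa only [hf.reg Reg.val (by decide)] using hI
  · rw [h₁.2.2.2]
    exact .zero
  · refine ((runs_testLetter (a := ⟨b, hb⟩) ((h.frame hf₁).frame hf) ht hi hj
      ((hf.reg _ (by decide)).trans h₁.1) ((hf.reg _ (by decide)).trans h₁.2.1)
      ((hf.reg _ (by decide)).trans h₁.2.2.1) hletter ?_).seq fun s₃ hf₃ h₃ =>
        Runs.cond (e := .reg Reg.next) (T := 10) h₃.1 h₃.2 (fun hleads => Runs.assign ?_ ?_)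
          fun hleads => Runs.skip ?_)
    · rw [hf.arr _ (by decide), hf₁.arr _ (by decide)]
      exact hprev
    all_goals have hletter' := (hf₃.reg Reg.letter (by decide)).trans hletter
    · simp [hletter']; omega
    · simpa [hletter'] using IsWitness.succ hleads
    · simpa [hf₃.reg Reg.val (by decide)] using hI.mono hleads

/-- For all `t, i, j ≤ n`, the array `L` tells which letter starts a path of length `t + 1` from
`(i, j)` to the sink. -/
def IsLengthTable (w : List (Fin σ)) (L : ℕ → ℕ) : Prop :=
  ∀ t ≤ w.length, ∀ i ≤ w.length, ∀ j ≤ w.length,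
    IsWitness (Leads w t i j) σ (L ((t * (w.length + 1) + i) * (w.length + 1) + j))

/-- Fill the table `lengths`, in the order of increasing lengths. -/
def fillLengths : Cmd :=
  Reg.size ::= .reg Reg.width * .reg Reg.width * .reg Reg.width ;; tabulate lengths lengthEntry

theorem runs_fillLengths (h : Ready W w s) :
    Runs W ((w.length + 1) ^ 3 * (σ * 60 + 51) + 12) fillLengths s fun s' =>
      Ready W w s' ∧ IsLengthTable w (s'.arr lengths) := by
  have hcube : (w.length + 1) * (w.length + 1) * (w.length + 1) = (w.length + 1) ^ 3 := by ring
  have hword := h.word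
  have hlen_lt := h.len_lt
  have hσ := h.alph_le
  have hsq : (w.length + 1) * (w.length + 1) ≤ (w.length + 1) * (w.length + 1) * (w.length + 1) :=
    Nat.le_mul_of_pos_right _ (Nat.succ_pos _)
  refine ((Runs.assign (T := 6) (Q := fun s' => s'.reg Reg.size =
    (w.length + 1) * (w.length + 1) * (w.length + 1)) (by simp [h.width]; omega)
      (by simp [h.width])).seq fun s₁ hf₁ hsize => ?_).mono_time (T := 6 +
        ((w.length + 1) * (w.length + 1) * (w.length + 1) * (σ * 60 + 40 + 11) + 6))
        (by rw [hcube, Nat.add_assoc (σ * 60)]; omega)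
  replace h := h.frame hf₁
  refine (Runs.tabulate (m := (w.length + 1) * (w.length + 1)) (q := w.length + 1)
    (P := fun r j v => IsWitness (Leads w (r / (w.length + 1)) (r % (w.length + 1)) j) σ v)
    (by decide) (by decide) (by decide) hsize (by omega)
    fun r hr j s₂ hcell hf hrows => ?_).imp fun s₂ hf hP => ⟨h.frame hf, fun t ht i hi j hj => ?_⟩
  · have ht : r / (w.length + 1) ≤ w.length := Nat.lt_succ_iff.1 (Nat.div_lt_of_lt_mul hr)
    have hi : r % (w.length + 1) ≤ w.length := Nat.lt_succ_iff.1 (Nat.mod_lt r (Nat.succ_pos _))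
    refine (runs_lengthEntry (h.frame hf) ht hi (Nat.lt_succ_iff.1 j.2)
      (by rwa [Nat.div_add_mod']) fun t k htk hk => ?_).imp
        fun s₃ _ hval => ⟨hval.1.trans_lt (by omega), hval⟩
    have hlt : t * (w.length + 1) + k < r := by
      rw [← Nat.div_add_mod' r (w.length + 1), htk, Nat.succ_mul]; omega
    have hdiv := mul_add_div_eq (i := t) (Nat.lt_add_one_of_le hk)
    have hmod := mul_add_mod_eq (i := t) (Nat.lt_add_one_of_le hk)
    simpa only [hdiv, hmod] using hrows _ hlt ⟨_, Nat.lt_succ_iff.2 hi⟩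
  · have hcell := mul_add_lt_mul (Nat.lt_add_one_of_le ht) (Nat.lt_add_one_of_le hi)
    have hdiv := mul_add_div_eq (i := t) (Nat.lt_add_one_of_le hi)
    have hmod := mul_add_mod_eq (i := t) (Nat.lt_add_one_of_le hi)
    simpa only [hdiv, hmod] using hP _ hcell ⟨j, Nat.lt_succ_iff.2 hj⟩

end Lengths

/-! ### Minimal absent subsequences of given and of maximal length -/

section Longest

variable {σ W l m t i j : ℕ} {w : List (Fin σ)} {s s₁ : State} {L : ℕ → ℕ}

theorem exists_isMAS (w : List (Fin σ)) (hσ : 1 ≤ σ) : ∃ v, IsMAS w v := by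
  have hne : {v : List (Fin σ) | ¬ v.Sublist w}.Nonempty :=
    ⟨List.replicate (w.length + 1) ⟨0, hσ⟩, fun h => by simpa using h.length_le⟩
  obtain ⟨v, hv, hmin⟩ := exists_minimalFor_of_wellFoundedLT _ List.length hne
  refine ⟨v, hv, fun u huv hne => ?_⟩
  by_contra hu
  exact hne (huv.eq_of_length_le (hmin hu huv.length_le))

theorem IsMAS.length_pos {v : List (Fin σ)} (h : IsMAS w v) : 0 < v.length :=
  List.length_pos_iff.2 fun hv => h.1 (hv ▸ List.nil_sublist w)

theorem IsLengthTable.root_ne_zero_iff (h : IsLengthTable w L) (ht : t ≤ w.length) :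
    L (t * (w.length + 1) * (w.length + 1)) ≠ 0 ↔ ∃ v, IsMAS w v ∧ v.length = t + 1 := by
  have hroot := (h t ht 0 (Nat.zero_le _) 0 (Nat.zero_le _)).ne_zero_iff
  rw [exists_leads_iff (Nat.zero_le _) (Nat.zero_le _)] at hroot
  simpa only [add_zero, accepts_zero, and_comm] using hroot

/-- Compute the table of lengths, which is not among the stored data structures. -/
def prepare : Cmd := setup ;; fillLengths

theorem runs_prepare (h : Ready W w s₁) (hs : IsQueryStart s₁ s) :
    Runs W (133 * (w.length + 1) ^ 4) prepare s
      fun s' => Ready W w s' ∧ IsLengthTable w (s'.arr lengths) := by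
  refine ((runs_setup_of_isQueryStart h hs).seq fun s' _ h' => runs_fillLengths h').mono_time ?_
  have hσ := h.alph_le
  have hpos : 0 < (w.length + 1) ^ 4 := by positivity
  calc 10 + ((w.length + 1) ^ 3 * (σ * 60 + 51) + 12)
      ≤ (w.length + 1) ^ 3 * (111 * (w.length + 1)) + 22 := by
        have := Nat.mul_le_mul_left ((w.length + 1) ^ 3)
          (show σ * 60 + 51 ≤ 111 * (w.length + 1) by omega)
        omega
    _ = 111 * (w.length + 1) ^ 4 + 22 := by ring
    _ ≤ 133 * (w.length + 1) ^ 4 := by omega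

/-- The entry of the table of lengths for the root and the given row. -/
def rootLength (row : Expr) : Expr := .read lengths (row * .reg Reg.width * .reg Reg.width)

theorem val_rootLength {row : Expr} (h : Ready W w s) (hrow : row.val s = t) :
    (rootLength row).val s = s.arr lengths (t * (w.length + 1) * (w.length + 1)) := by
  simp [rootLength, hrow, h.width]

theorem fits_rootLength {row : Expr} (h : Ready W w s) (hL : IsLengthTable w (s.arr lengths))
    (ht : t ≤ w.length) (hrow : row.val s = t) (hfits : row.Fits W s) :
    (rootLength row).Fits W s := by
  have hlen_lt := h.len_lt
  have hσ := h.alph_le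
  have hwidth := h.width
  have hcell_lt := h.length_lt ht (Nat.zero_le _) (Nat.zero_le _)
  have hentry_le := (hL t ht 0 (Nat.zero_le _) 0 (Nat.zero_le _)).1
  have hmul : t * (w.length + 1) ≤ t * (w.length + 1) * (w.length + 1) :=
    Nat.le_mul_of_pos_right _ (Nat.succ_pos _)
  simp only [add_zero] at hcell_lt hentry_le
  simp [rootLength, hrow, hwidth, hfits]
  omega

/-- Decide whether there is a minimal absent subsequence of the length given in the query. -/
def ofLength : Cmd :=
  prepare ;; Reg.size ::= .read .query 0 ;;
  .cond ((0 <ₑ .reg Reg.size) * (.reg Reg.size <ₑ .reg Reg.width + 1))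
    (.output (0 <ₑ rootLength (.reg Reg.size - 1))) (.output 0)

theorem answers_ofLength (h : Ready W w s₁) (hs : IsQueryStart s₁ s) (hl : l < W)
    (hq : s.arr .query = load [l]) :
    Answers W ofLength s fun s' => s'.clock ≤ 300 * (w.length + 1) ^ 4 ∧
      s'.Decides (∃ v, IsMAS w v ∧ v.length = l) := by
  classical
  have hpos : 0 < (w.length + 1) ^ 4 := by positivity
  have hruns : Runs W (133 * (w.length + 1) ^ 4 + 30) ofLength s
      fun s' => s'.Decides (∃ v, IsMAS w v ∧ v.length = l) := by
    refine (runs_prepare h hs).seq fun s' hf ⟨h, hL⟩ => ?_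
    have hlen_lt := h.len_lt
    have hwidth := h.width
    have hread : s'.arr .query 0 = l := by rw [hf.arr .query (by decide), hq]; rfl
    have hout : s'.out = [] := (hf.out rfl).trans hs.2.2
    refine Runs.seq (T₁ := 4) (T₂ := 26) (P := fun s' => s'.reg Reg.size = l) (Runs.assign ?_ ?_)
      fun s₂ hf₂ hsize => ?_
    · simp [hread]; omega
    · simp [hread]
    have h₂ := h.frame hf₂
    have hL₂ : s₂.arr lengths = s'.arr lengths := hf₂.arr _ (by decide)
    have hout₂ : s₂.out = [] := (hf₂.out rfl).trans hout
    refine Runs.cond (p := l ≠ 0 ∧ l ≤ w.length + 1) ?_ ?_ (fun hl => ?_) fun hl => ?_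
    · simp [hsize, h₂.width]; split_ifs <;> omega
    · simp [hsize, h₂.width]; omega
    · have ht : l - 1 ≤ w.length := by omega
      have hrow : (Expr.reg Reg.size - 1).val s₂ = l - 1 := by simp [hsize]
      have hval := val_rootLength h₂ hrow
      have hfits := fits_rootLength h₂ (by rwa [hL₂]) ht hrow (by simp [hsize]; omega)
      rw [hL₂] at hval
      refine Runs.output_decides (by simp [hfits]; omega) hout₂ ?_
      have hiff := hL.root_ne_zero_iff ht
      rw [Nat.sub_add_cancel (by omega)] at hiff
      simp [hval, Nat.pos_iff_ne_zero, hiff]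
    · refine Runs.output_decides (by simp; omega) hout₂ ?_
      have hnone : ¬ ∃ v, IsMAS w v ∧ v.length = l := by
        rintro ⟨v, hv, rfl⟩
        exact hl ⟨hv.length_pos.ne', hv.length_le⟩
      simp [hnone]
  exact hruns.answers hs (by omega)

/-- Put the maximal length of a minimal absent subsequence into `Reg.size`. -/
def maxLength : Cmd :=
  Reg.size ::= 0 ;;
  forLoop Reg.row Reg.width
    (.cond (rootLength (.reg Reg.row)) (Reg.size ::= .reg Reg.row + 1) .skip)

theorem runs_maxLength (h : Ready W w s) (hL : IsLengthTable w (s.arr lengths)) :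
    Runs W ((w.length + 1) * 20 + 8) maxLength s fun s' => s'.reg Reg.size ≤ w.length + 1 ∧
      (∀ v, IsMAS w v → v.length ≤ s'.reg Reg.size) ∧
      (s'.reg Reg.size ≠ 0 → ∃ v, IsMAS w v ∧ v.length = s'.reg Reg.size) := by
  let I (t : ℕ) (s' : State) : Prop := s'.reg Reg.size ≤ t ∧
    (∀ v, IsMAS w v → v.length ≤ t → v.length ≤ s'.reg Reg.size) ∧
    (s'.reg Reg.size ≠ 0 → ∃ v, IsMAS w v ∧ v.length = s'.reg Reg.size)
  have hlen_lt := h.len_lt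
  refine ((Runs.assign (T := 2) (Q := fun s' => s'.reg Reg.size = 0) (by simp; omega)
    (by simp)).seq fun s₁ hf₁ hsize => (Runs.forLoop (I := I) (T := 12) (by decide) (by decide)
      (by decide) (h.frame hf₁).width (by omega) (fun t s s' hf hI => ?_) ?_
      fun t s₂ ht hrow hf hI => ?_).imp fun s' _ hI => ⟨hI.1, fun v hv => hI.2.1 v hv hv.length_le,
        hI.2.2⟩).mono_time (by omega)
  · simpa only [I, hf.reg Reg.size (by decide)] using hI
  · exact ⟨hsize.le, fun v _ hlen => hlen.trans (Nat.zero_le _), fun h => absurd hsize h⟩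
  · replace h := (h.frame hf₁).frame hf
    have hL₂ : s₂.arr lengths = s.arr lengths :=
      (hf.arr _ (by decide)).trans (hf₁.arr _ (by decide))
    rw [← hL₂] at hL
    have hval := val_rootLength (row := .reg Reg.row) h hrow
    refine Runs.cond (p := ∃ v, IsMAS w v ∧ v.length = t + 1)
      (fits_rootLength h hL (by omega) hrow (by simp [hrow]; omega)) ?_ (fun hmas => ?_)
      fun hmas => ?_
    · rw [hval, hL.root_ne_zero_iff (by omega)]
    · refine Runs.assign (by simp [hrow]; omega) ?_
      simpa [I, hrow] using hmas
    · refine Runs.skip ⟨hI.1.trans (Nat.le_succ t), fun v hv hlen => hI.2.1 v hv ?_, hI.2.2⟩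
      have hne : v.length ≠ t + 1 := fun h => hmas ⟨v, hv, h⟩
      omega

/-- In the state `(i, j)`, having written a word of length `t` to the output, one can still
complete it to a minimal absent subsequence of length `m`. -/
def IsWalk (w : List (Fin σ)) (m t i j : ℕ) (out : List ℕ) : Prop :=
  ∃ pre : List (Fin σ), out = code pre ∧ pre.length = t ∧
    (∀ u, Accepts w i j u → IsMAS w (pre ++ u)) ∧ ∃ u, u.length = m - t ∧ Accepts w i j u

theorem isWalk_zero {v : List (Fin σ)} (hv : IsMAS w v) : IsWalk w v.length 0 0 0 [] :=
  ⟨[], rfl, rfl, fun _ => accepts_zero.1, v, rfl, accepts_zero.2 hv⟩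

theorem IsWalk.exists_isMAS {out : List ℕ} (h : IsWalk w m m i j out) :
    ∃ v, IsMAS w v ∧ v.length = m ∧ out = code v := by
  obtain ⟨pre, hout, hlen, hmas, u, hu, haccepts⟩ := h
  obtain rfl : u = [] := List.eq_nil_of_length_eq_zero (by omega)
  exact ⟨pre, by simpa using hmas [] haccepts, hlen, hout⟩

theorem IsWalk.exists_leads {out : List ℕ} (h : IsWalk w m t i j out) (ht : t < m)
    (hj : j ≤ w.length) : i ≤ w.length ∧ ∃ a, Leads w (m - 1 - t) i j a := by
  obtain ⟨-, -, -, -, u, hlen, hu⟩ := h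
  obtain ⟨a, u, rfl⟩ := List.exists_cons_of_length_pos (l := u) (by omega)
  have hi := ((accepts_cons_iff hj).1 hu).1
  exact ⟨hi, (exists_leads_iff hi hj).2 ⟨a :: u, by omega, hu⟩⟩

theorem IsWalk.succ {out : List ℕ} {a : Fin σ} (h : IsWalk w m t i j out) (hi : i ≤ w.length)
    (hj : j ≤ w.length) (ha : Leads w (m - 1 - t) i j a) :
    IsWalk w m (t + 1) (target w i j a) i (out ++ [(a : ℕ) + 1]) := by
  obtain ⟨pre, rfl, rfl, hmas, -⟩ := h
  obtain ⟨htarget, u, hlen, hu⟩ := ha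
  refine ⟨pre ++ [a], by simp [code_eq_map], by simp, fun u hu => ?_, u, by omega, hu⟩
  rw [List.append_assoc]
  exact hmas _ ((accepts_cons_iff hj).2 ⟨hi, htarget, hu⟩)

/-- Write the first letter of a path of the required length to the sink, and follow its edge. -/
def writeLetter : Cmd :=
  (Reg.letter ::= .read lengths (((.reg Reg.size - 1 - .reg Reg.cell) * .reg Reg.width +
      .reg Reg.fst) * .reg Reg.width + .reg Reg.snd) - 1 ;;
    Reg.val ::= edge) ;;
  .output (.reg Reg.letter + 1) ;; Reg.snd ::= .reg Reg.fst ;; Reg.fst ::= .reg Reg.val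

theorem runs_writeLetter (h : Ready W w s) (hL : IsLengthTable w (s.arr lengths))
    (hm : m ≤ w.length + 1) (ht : t < m) (hj : j ≤ w.length) (hsize : s.reg Reg.size = m)
    (hcell : s.reg Reg.cell = t) (hfst : s.reg Reg.fst = i) (hsnd : s.reg Reg.snd = j)
    (hwalk : IsWalk w m t i j s.written) :
    Runs W 50 writeLetter s fun s' => s'.reg Reg.snd ≤ w.length ∧
      IsWalk w m (t + 1) (s'.reg Reg.fst) (s'.reg Reg.snd) s'.written := by
  obtain ⟨hi, hleads⟩ := hwalk.exists_leads ht hj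
  obtain ⟨a, hentry, ha⟩ := (hL (m - 1 - t) (by omega) i hi j hj).exists_eq hleads
  have hnext := hwalk.succ hi hj ha
  have hle : target w i j a ≤ w.length + 1 := target_le hi
  have hlen_lt := h.len_lt
  have hσ := h.alph_le
  have := a.2
  refine Runs.seq (T₁ := 32) (T₂ := 18) (P := fun s' => s'.reg Reg.letter = a ∧
    s'.reg Reg.val = target w i j a) (Runs.seq (T₁ := 20) (T₂ := 12)
      (P := fun s' => s'.reg Reg.letter = a) (Runs.assign ?_ ?_) fun s₁ hf₁ hletter => ?_)
    fun s₂ hf₂ ⟨hletter, hval⟩ => Runs.seq (T₁ := 5) (T₂ := 13)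
      (P := fun s' => s'.written = s.written ++ [(a : ℕ) + 1])
      (Runs.output ?_ ?_) fun s₃ hf₃ hout => Runs.assign_seq ?_ (Runs.assign ?_ ?_)
  · have hcell_lt := h.length_lt (t := m - 1 - t) (by omega) hi hj
    have hmul : (m - 1 - t) * (w.length + 1) + i ≤
        ((m - 1 - t) * (w.length + 1) + i) * (w.length + 1) :=
      Nat.le_mul_of_pos_right _ (Nat.succ_pos _)
    simp [hsize, hcell, hfst, hsnd, h.width, hentry]; omega
  · simp [hsize, hcell, hfst, hsnd, h.width, hentry]
  · have h₁ := h.frame hf₁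
    have hfst₁ := (hf₁.reg Reg.fst (by decide)).trans hfst
    have hsnd₁ := (hf₁.reg Reg.snd (by decide)).trans hsnd
    exact Runs.assign (h₁.fits_edge hi hj hfst₁ hsnd₁ hletter)
      (by simpa [hletter] using h₁.val_edge hi hj hfst₁ hsnd₁ hletter)
  · simp [hletter]; omega
  · simp [State.written, hletter, hf₂.out rfl]
  all_goals
    have hfst₃ := ((hf₃.reg Reg.fst (by decide)).trans (hf₂.reg Reg.fst (by decide))).trans hfst
    have hval₃ := (hf₃.reg Reg.val (by decide)).trans hval
  · simp [hfst₃]; omega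
  · simp [hval₃]; omega
  · rw [State.written] at hout ⊢
    simpa [hfst₃, hval₃, hi, hout] using hnext

/-- Write a longest minimal absent subsequence. -/
def longest : Cmd :=
  prepare ;; maxLength ;; (Reg.fst ::= 0 ;; Reg.snd ::= 0) ;; forLoop Reg.cell Reg.size writeLetter

theorem runs_walk (h : Ready W w s) (hL : IsLengthTable w (s.arr lengths))
    (hm : m ≤ w.length + 1) (hsize : s.reg Reg.size = m) (hsnd : s.reg Reg.snd = 0)
    (hfst : s.reg Reg.fst = 0) (hwalk : IsWalk w m 0 0 0 s.written) :
    Runs W (m * 58 + 6) (forLoop Reg.cell Reg.size writeLetter) s fun s' =>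
      ∃ v, IsMAS w v ∧ v.length = m ∧ s'.written = code v := by
  have hlen_lt := h.len_lt
  refine (Runs.forLoop (I := fun t s' => s'.reg Reg.snd ≤ w.length ∧
    IsWalk w m t (s'.reg Reg.fst) (s'.reg Reg.snd) s'.written) (by decide) (by decide) (by decide)
      hsize (by omega) (fun t s s' hf hI => ?_) ?_ fun t s₁ ht hcell hf hI => ?_).imp
      fun s' _ hI => hI.2.exists_isMAS
  · simpa only [hf.reg Reg.fst (by decide), hf.reg Reg.snd (by decide), State.written,
      hf.out rfl] using hI
  · simpa [hfst, hsnd] using hwalk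
  · exact runs_writeLetter (h.frame hf) (by rwa [hf.arr _ (by decide)]) hm ht hI.1
      ((hf.reg _ (by decide)).trans hsize) hcell rfl rfl hI.2

theorem answers_longest (hσ : 1 ≤ σ) (h : Ready W w s₁) (hs : IsQueryStart s₁ s) :
    Answers W longest s fun s' => s'.clock ≤ 300 * (w.length + 1) ^ 4 ∧
      ∃ v, IsMAS w v ∧ (∀ v', IsMAS w v' → v'.length ≤ v.length) ∧ s'.written = code v := by
  have hruns : Runs W (133 * (w.length + 1) ^ 4 + (((w.length + 1) * 20 + 8) + (4 +
      ((w.length + 1) * 58 + 6)))) longest s fun s' =>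
      ∃ v, IsMAS w v ∧ (∀ v', IsMAS w v' → v'.length ≤ v.length) ∧ s'.written = code v := by
    refine (runs_prepare h hs).seq fun s₂ hf₂ ⟨h₂, hL⟩ => (runs_maxLength h₂ hL).seq
      fun s₃ hf₃ ⟨hle, hmax, hmas⟩ => ?_
    obtain ⟨v₀, hv₀⟩ := exists_isMAS w hσ
    obtain ⟨v, hv, hlen⟩ := hmas (hv₀.length_pos.trans_le (hmax v₀ hv₀)).ne'
    rw [← hlen] at hle hmax
    have h₃ := h₂.frame hf₃
    have hlen_lt := h.len_lt
    refine Runs.seq (P := fun s' => s'.reg Reg.fst = 0 ∧ s'.reg Reg.snd = 0)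
      (Runs.assign_seq (by simp; omega) (Runs.assign (by simp; omega) (by simp)))
      fun s₄ hf₄ ⟨hfst, hsnd⟩ => ((runs_walk (m := v.length) (h₃.frame hf₄) ?_ hle
        ((hf₄.reg _ (by decide)).trans hlen.symm) hsnd hfst ?_).mono_time (by omega)).imp
        fun s' _ ⟨v', hv', hlen', hout⟩ => ⟨v', hv', by rwa [hlen'], hout⟩
    · rwa [hf₄.arr _ (by decide), hf₃.arr _ (by decide)]
    · rw [State.written, hf₄.out rfl, hf₃.out rfl, hf₂.out rfl, hs.2.2]
      exact isWalk_zero hv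
  refine hruns.answers hs ?_
  have hpow := Nat.le_self_pow (show 4 ≠ 0 by decide) (w.length + 1)
  omega

end Longest

/-! ### Enumeration -/

section Holds

variable {f : ℕ → ℕ} {l l' : List ℕ} {v : ℕ}

/-- The array `f` starts with the list `l`. -/
def Holds (f : ℕ → ℕ) (l : List ℕ) : Prop := ∀ x (h : x < l.length), f x = l[x]

theorem Holds.of_append (h : Holds f (l ++ l')) : Holds f l := fun x hx =>
  (h x (by rw [List.length_append]; omega)).trans (List.getElem_append_left hx)

theorem Holds.update_length (h : Holds f l) :
    Holds (Function.update f l.length v) (l ++ [v]) := by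
  intro x hx
  rw [List.length_append, List.length_singleton] at hx
  rcases Nat.lt_succ_iff_lt_or_eq.1 hx with hlt | rfl
  · rw [Function.update_of_ne hlt.ne, h x hlt, List.getElem_append_left hlt]
  · rw [Function.update_self, List.getElem_concat_length rfl]

theorem Holds.apply_length (h : Holds f (l ++ v :: l')) : f l.length = v := by
  rw [h l.length (by simp), List.getElem_append_right le_rfl]
  simp

end Holds

section Iterates

variable {W T : ℕ} {e : Expr} {c : Cmd} {s s' : State} {Q : State → Prop}

/-- Some rounds of the loop `.loop e c` lead from `s` to `s'`. -/
def Iterates (W : ℕ) (e : Expr) (c : Cmd) : State → State → Prop :=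
  Relation.ReflTransGen fun s s' => e.Fits W s ∧ e.val s ≠ 0 ∧ Exec W c (s.tick (e.cost + 1)) s'

theorem Iterates.exec_loop (h : Iterates W e c s s') (he : e.Fits W s') (hv : e.val s' = 0) :
    Exec W (.loop e c) s (s'.tick (e.cost + 1)) := by
  induction h using Relation.ReflTransGen.head_induction_on with
  | refl => exact .loop_false _ _ _ (by rw [he.eval_eq, hv])
  | head hstep _ ih => exact .loop_true _ _ _ _ _ _ hstep.1.eval_eq hstep.2.1 hstep.2.2 ih

theorem Runs.exists_iterates (h : Runs W T c (s.tick (e.cost + 1)) Q) (he : e.Fits W s)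
    (hv : e.val s ≠ 0) :
    ∃ s', Iterates W e c s s' ∧ s'.clock ≤ s.clock + (e.cost + 1 + T) ∧ Q s' := by
  obtain ⟨s', hexec, htime, hQ⟩ := h
  exact ⟨s', .single ⟨he, hv, hexec⟩, by rw [State.tick_clock] at htime; omega, hQ⟩

end Iterates

section Late

variable {d x y δ : ℕ} {s s' : State}

/-- The times at which an end mark was written. -/
def State.marks (s : State) : List ℕ := (s.out.filter fun p => p.2 = 0).map Prod.fst

/-- Up to now the delay has been at most `d`, and the last end mark (or the start) is at most `x`
time units ago. -/
structure Late (d x : ℕ) (s : State) : Prop where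
  isChain : List.IsChain (fun t t' => t' ≤ t + d) (0 :: s.marks)
  clock_le : s.clock ≤ s.marks.getLastD 0 + x

theorem Late.mono (h : Late d x s) (hout : s'.out = s.out) (hclock : s'.clock ≤ s.clock + δ)
    (hxy : x + δ ≤ y) : Late d y s' := by
  have hmarks : s'.marks = s.marks := by rw [State.marks, hout, ← State.marks]
  refine ⟨hmarks ▸ h.isChain, ?_⟩
  have := h.clock_le
  rw [hmarks]; omega

theorem Late.isChain_concat {t : ℕ} (h : Late d x s) (ht : t ≤ s.clock + δ) (hx : x + δ ≤ d) :
    List.IsChain (fun t t' => t' ≤ t + d) (0 :: s.marks ++ [t]) := by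
  refine List.isChain_append.2 ⟨h.isChain, .singleton _, fun t₁ ht₁ t₂ ht₂ => ?_⟩
  have hclock := h.clock_le
  simp only [List.getLast?_cons, List.getLastD_eq_getLast?, Option.mem_def, Option.some.injEq,
    List.head?_cons] at ht₁ ht₂ hclock
  omega

theorem Late.mark (h : Late d x s) (hmarks : s'.marks = s.marks ++ [s'.clock])
    (hclock : s'.clock ≤ s.clock + δ) (hx : x + δ ≤ d) : Late d y s' where
  isChain := hmarks ▸ h.isChain_concat hclock hx
  clock_le := by rw [hmarks, List.getLastD_concat]; omega

end Late

section Search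

@[simp] abbrev Reg.depth : ℕ := 11

/-- The stack of the first components of the nodes on the current path. -/
abbrev positions : Arr := .work 1

/-- The stack of the letters to be tried next at these nodes. As letter `a` is encoded as `a + 1` in
the output, what lies below the top is also the code of the label of the current path. -/
abbrev letters : Arr := .work 2

/-- Descend to the node whose first component is in `Reg.val`. -/
def push : Cmd :=
  Reg.depth ::= .reg Reg.depth + 1 ;; .store positions (.reg Reg.depth) (.reg Reg.val) ;;
    .store letters (.reg Reg.depth - 1) 0

/-- Write the label of the current path, extended by the letter that has just been tried. -/
def writeWord : Cmd :=
  forLoop Reg.cell Reg.depth (.output (.read letters (.reg Reg.cell))) ;; .output 0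

/-- Record that the letter in `Reg.letter` has been tried at the current node. -/
def advance : Cmd := .store letters (.reg Reg.depth - 1) (.reg Reg.letter + 1)

/-- Look up the edge for the letter in `Reg.letter` at the current node. -/
def readEdge : Cmd :=
  (Reg.fst ::= .read positions (.reg Reg.depth) ;;
    Reg.snd ::= .read positions (.reg Reg.depth - 1)) ;;
  Reg.val ::= edge

/-- Follow the edge in `Reg.val`, if there is one: descend to its target, or write a word if this is
the sink. -/
def followEdge : Cmd :=
  .cond (.reg Reg.val) (.cond (.reg Reg.val <ₑ .reg Reg.width) push writeWord) .skip

/-- One step of a depth-first search, which follows the edge for the next letter at the current node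
or returns to the parent of this node. -/
def searchStep : Cmd :=
  Reg.letter ::= .read letters (.reg Reg.depth - 1) ;;
  .cond (.reg Reg.letter <ₑ .reg Reg.alph)
    (advance ;; readEdge ;; followEdge)
    (Reg.depth ::= .reg Reg.depth - 1)

/-- Initialize the stacks, with an additional `0` for the second component of the root. -/
def enterRoot : Cmd :=
  .store positions 0 0 ;; .store positions 1 0 ;; .store letters 0 0 ;; Reg.depth ::= 1

/-- Depth-first search through the graph, which writes a word whenever it reaches the sink. -/
def enumerate : Cmd := (setup ;; enterRoot) ;; .loop (.reg Reg.depth) searchStep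

variable {σ W : ℕ} {w pre : List (Fin σ)} {ps : List ℕ} {i j b : ℕ} {a : Fin σ} {s s' : State}
  {F : Footprint}

theorem length_code (v : List (Fin σ)) : (code v).length = v.length := by simp [code_eq_map]

theorem code_concat (v : List (Fin σ)) (a : Fin σ) : code (v ++ [a]) = code v ++ [(a : ℕ) + 1] := by
  simp [code_eq_map]

/-- The search has come along the path with label `pre` to the node `(i, j)`, and the letter to be
tried next is `b`. The stack of positions is `ps ++ [j, i]`. -/
structure AtNode (W : ℕ) (w pre : List (Fin σ)) (ps : List ℕ) (j i b : ℕ) (s : State) : Prop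
    extends Ready W w s where
  isPair : IsPair w.length i j
  length_le : pre.length ≤ i
  length_eq : ps.length = pre.length
  depth : s.reg Reg.depth = pre.length + 1
  holds_positions : Holds (s.arr positions) (ps ++ [j, i])
  holds_letters : Holds (s.arr letters) (code pre ++ [b])

namespace AtNode

theorem frame (h : AtNode W w pre ps j i b s) (hf : Frame F s s')
    (hF : ((Reg.len ∉ F.regs ∧ Reg.alph ∉ F.regs ∧ Reg.width ∉ F.regs ∧ .input ∉ F.arrs) ∧
      edges ∉ F.arrs) ∧ Reg.depth ∉ F.regs ∧ positions ∉ F.arrs ∧ letters ∉ F.arrs := by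
        decide) : AtNode W w pre ps j i b s' where
  __ := h
  toReady := h.toReady.frame hf hF.1
  depth := (hf.reg _ hF.2.1).trans h.depth
  holds_positions := by rw [hf.arr _ hF.2.2.1]; exact h.holds_positions
  holds_letters := by rw [hf.arr _ hF.2.2.2]; exact h.holds_letters

theorem tick (h : AtNode W w pre ps j i b s) (t : ℕ) : AtNode W w pre ps j i b (s.tick t) :=
  h.frame (Frame.tick (F := ⟨[], [], false⟩) s t)

theorem position_depth (h : AtNode W w pre ps j i b s) :
    s.arr positions (pre.length + 1) = i := by
  have hholds : Holds (s.arr positions) ((ps ++ [j]) ++ [i]) := by simpa using h.holds_positions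
  simpa [h.length_eq] using hholds.apply_length

theorem position_pred (h : AtNode W w pre ps j i b s) :
    s.arr positions pre.length = j := h.length_eq ▸ h.holds_positions.apply_length

theorem letter (h : AtNode W w pre ps j i b s) : s.arr letters pre.length = b :=
  length_code pre ▸ h.holds_letters.apply_length

theorem depth_lt (h : AtNode W w pre ps j i b s) : pre.length + 10 < W := by
  have := h.length_le
  have := h.isPair.fst_le
  have := h.len_lt
  omega

end AtNode

theorem runs_enterRoot (h : Ready W w s) :
    Runs W 14 enterRoot s (AtNode W w [] [] 0 0 0) := by
  have hlen_lt := h.len_lt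
  have hstored : Runs W 14 enterRoot s fun s' => s'.reg Reg.depth = 1 ∧
      s'.arr positions 0 = 0 ∧ s'.arr positions 1 = 0 ∧ s'.arr letters 0 = 0 := by
    refine Runs.seq (T₁ := 3) (T₂ := 11) (P := fun s' => s'.arr positions 0 = 0)
      (Runs.store ?_ ?_ ?_) fun s₁ _ h₁ => Runs.seq (T₁ := 3) (T₂ := 8)
      (P := fun s' => s'.arr positions 0 = 0 ∧ s'.arr positions 1 = 0)
      (Runs.store ?_ ?_ ?_) fun s₂ _ h₂ => Runs.seq (T₁ := 3) (T₂ := 5)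
      (P := fun s' => s'.arr positions 0 = 0 ∧ s'.arr positions 1 = 0 ∧ s'.arr letters 0 = 0)
      (Runs.store ?_ ?_ ?_) fun s₃ _ h₃ => Runs.assign ?_ ?_
    · simp; omega
    · simp; omega
    · simp
    · simp; omega
    · simp; omega
    · simp [h₁]
    · simp; omega
    · simp; omega
    · simp [h₂]
    · simp; omega
    · simp [h₃]
  refine hstored.imp fun s' hf ⟨hdepth, hpos₀, hpos₁, hletter⟩ =>
    ⟨h.frame hf, isPair_zero, le_rfl, rfl, hdepth, fun x hx => ?_, fun x hx => ?_⟩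
  · obtain rfl | rfl : x = 0 ∨ x = 1 := by simp at hx; omega
    exacts [hpos₀, hpos₁]
  · obtain rfl : x = 0 := by simpa [length_code] using hx
    exact hletter

theorem runs_push (h : AtNode W w pre ps j i (a + 1) s) (hne : target w i j a ≠ 0)
    (hle : target w i j a ≤ w.length) (hval : s.reg Reg.val = target w i j a) :
    Runs W 20 push s (AtNode W w (pre ++ [a]) (ps ++ [j]) i (target w i j a) 0) := by
  have hlt := lt_target hne
  have hdepth_lt := h.depth_lt
  have hlen := h.length_le
  have hlen_lt := h.len_lt
  have hstored : Runs W 20 push s fun s' => s'.reg Reg.depth = pre.length + 2 ∧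
      s'.arr positions = Function.update (s.arr positions) (pre.length + 2) (target w i j a) ∧
      s'.arr letters = Function.update (s.arr letters) (pre.length + 1) 0 := by
    refine Runs.assign_seq ?_ (Runs.seq (T₁ := 3) (T₂ := 13) (P := fun s' =>
      s'.arr positions = Function.update (s.arr positions) (pre.length + 2) (target w i j a))
      (Runs.store ?_ ?_ ?_) fun s₁ hf₁ hpos₁ => ?_)
    · simp [h.depth]; omega
    · simp [h.depth]; omega
    · simp [hval]; omega
    · simp [h.depth, hval]
    have hdepth₁ : s₁.reg Reg.depth = pre.length + 2 := by
      rw [hf₁.reg _ (by decide)]; simp [h.depth]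
    have hletters₁ : s₁.arr letters = s.arr letters := hf₁.arr _ (by decide)
    refine Runs.store ?_ ?_ ⟨?_, ?_, ?_⟩
    · simp [hdepth₁]; omega
    · simp; omega
    · exact hdepth₁
    · simpa using hpos₁
    · simp [hdepth₁, hletters₁]
  refine hstored.imp fun s' hf ⟨hdepth, hpos, hletters⟩ =>
    ⟨h.toReady.frame hf, isPair_target hne hle, ?_, ?_, ?_, ?_, ?_⟩
  · simp; omega
  · simp [h.length_eq]
  · simpa using hdepth
  · simpa [hpos, h.length_eq] using h.holds_positions.update_length (v := target w i j a)
  · simpa [hletters, length_code, code_concat] using h.holds_letters.update_length (v := 0)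

theorem code_lt (h : σ < W) {v : List (Fin σ)} {x : ℕ} (hx : x ∈ code v) : 0 < x ∧ x < W := by
  obtain ⟨b, -, rfl⟩ := List.mem_map.1 (code_eq_map ▸ hx)
  omega

theorem runs_writeWord {l : List ℕ} (hl : ∀ x ∈ l, 0 < x ∧ x < W) (hW : l.length < W)
    (hdepth : s.reg Reg.depth = l.length) (hletters : Holds (s.arr letters) l) :
    Runs W (12 * l.length + 8) writeWord s fun s' =>
      s'.written = s.written ++ (l ++ [0]) ∧ s'.marks = s.marks ++ [s'.clock] := by
  have hloop := Runs.forLoop (W := W) (s := s) (x := Reg.cell) (b := Reg.depth) (T := 4)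
    (c := .output (.read letters (.reg Reg.cell)))
    (I := fun t s' => s'.written = s.written ++ l.take t ∧ s'.marks = s.marks)
    (by decide) (by decide) (by decide) hdepth hW
    (fun t s₁ s₂ hf hI => by
      simpa only [State.written, State.marks, hf.out rfl] using hI) (by simp)
    fun t s' ht hcell hf hI => by
      have hread : s'.arr letters t = l[t] := by rw [hf.arr _ (by decide), hletters t ht]
      have hlt := hl _ (List.getElem_mem ht)
      refine Runs.output ?_ ⟨?_, ?_⟩
      · simp [hcell, hread]; omega
      · rw [List.take_succ_eq_append_getElem ht, ← List.append_assoc, ← hI.1]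
        simp [State.written, hcell, hread]
      · rw [← hI.2]
        simp [State.marks, hcell, hread]; omega
  refine (hloop.seq fun s' _ hI => Runs.output (T := 2) ?_ ⟨?_, ?_⟩).mono_time (by omega)
  · simp; omega
  · rw [← List.append_assoc, ← l.take_length, ← hI.1]
    simp [State.written]
  · rw [← hI.2]
    simp [State.marks]

theorem runs_advance (h : AtNode W w pre ps j i a s) (hletter : s.reg Reg.letter = a) :
    Runs W 7 advance s (AtNode W w pre ps j i (a + 1)) := by
  have hdepth_lt := h.depth_lt
  have hlen_lt := h.len_lt
  have hσ := h.alph_le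
  have := a.2
  have hstored : Runs W 7 advance s fun s' =>
      s'.arr letters = Function.update (s.arr letters) pre.length (a + 1) := by
    refine Runs.store ?_ ?_ ?_
    · simp [h.depth]; omega
    · simp [hletter]; omega
    · simp [h.depth, hletter]
  refine hstored.imp fun s' hf hletters =>
    { h with
      toReady := h.toReady.frame hf
      depth := (hf.reg _ (by decide)).trans h.depth
      holds_positions := by rw [hf.arr _ (by decide)]; exact h.holds_positions
      holds_letters := ?_ }
  simpa only [hletters, length_code] using h.holds_letters.of_append.update_length (v := a + 1)

theorem runs_readEdge (h : AtNode W w pre ps j i b s) (hletter : s.reg Reg.letter = a) :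
    Runs W 20 readEdge s fun s' => s'.reg Reg.val = target w i j a := by
  have hdepth_lt := h.depth_lt
  have hlen_lt := h.len_lt
  have hi := h.isPair.fst_le
  have hj := h.isPair.snd_le
  have hpos_depth := h.position_depth
  have hpos_pred := h.position_pred
  have hdepth := h.depth
  have hload : Runs W 9 (Reg.fst ::= .read positions (.reg Reg.depth) ;;
      Reg.snd ::= .read positions (.reg Reg.depth - 1)) s
      fun s' => s'.reg Reg.fst = i ∧ s'.reg Reg.snd = j := by
    refine Runs.assign_seq ?_ (Runs.assign ?_ ⟨?_, ?_⟩)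
    · simp [hdepth, hpos_depth]; omega
    · simp [hdepth, hpos_pred]; omega
    · simp [hdepth, hpos_depth]
    · simp [hdepth, hpos_pred]
  refine Runs.seq (T₂ := 11) hload fun s' hf ⟨hfst, hsnd⟩ => ?_
  have hletter' : s'.reg Reg.letter = a := (hf.reg _ (by decide)).trans hletter
  have hready : Ready W w s' := h.toReady.frame hf
  refine Runs.assign (hready.fits_edge hi hj hfst hsnd hletter') ?_
  simpa using hready.val_edge hi hj hfst hsnd hletter'

/-- What one round of the search does at the node `(i, j)`, reached along `pre`, with the edge with
label `a`: there is none, or it is followed to the next node, or it completes a word, which is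
written to the output. -/
def Follows (W : ℕ) (w pre : List (Fin σ)) (ps : List ℕ) (j i : ℕ) (a : Fin σ) (s s' : State) :
    Prop :=
  target w i j a = 0 ∧ AtNode W w pre ps j i (a + 1) s' ∧ s'.out = s.out ∨
  (target w i j a ≠ 0 ∧ target w i j a ≤ w.length) ∧
    AtNode W w (pre ++ [a]) (ps ++ [j]) i (target w i j a) 0 s' ∧ s'.out = s.out ∨
  target w i j a = w.length + 1 ∧ AtNode W w pre ps j i (a + 1) s' ∧
    s'.written = s.written ++ (code (pre ++ [a]) ++ [0]) ∧ s'.marks = s.marks ++ [s'.clock]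

theorem runs_writeWord_follows (h : AtNode W w pre ps j i (a + 1) s)
    (htarget : target w i j a = w.length + 1) :
    Runs W (12 * w.length + 20) writeWord s (Follows W w pre ps j i a s) := by
  have hlength : (code (pre ++ [a])).length = pre.length + 1 := by simp [length_code]
  have hcode (x : ℕ) (hx : x ∈ code (pre ++ [a])) : 0 < x ∧ x < W :=
    code_lt (h.alph_le.trans_lt (by have := h.len_lt; omega)) hx
  have hdepth_lt := h.depth_lt
  have hlen := h.length_le.trans h.isPair.fst_le
  exact ((runs_writeWord hcode (by omega) (h.depth.trans hlength.symm)
    (code_concat pre a ▸ h.holds_letters)).imp fun s' hf h' =>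
      .inr (.inr ⟨htarget, h.frame hf, h'⟩)).mono_time (by omega)

theorem runs_followEdge (h : AtNode W w pre ps j i (a + 1) s)
    (hval : s.reg Reg.val = target w i j a) :
    Runs W (12 * w.length + 30) followEdge s (Follows W w pre ps j i a s) := by
  have hlen_lt := h.len_lt
  have hwidth := h.width
  have hle : target w i j a ≤ w.length + 1 := target_le h.isPair.fst_le
  have hT : 30 ≤ 12 * w.length + 30 := Nat.le_add_left _ _
  refine Runs.cond (p := target w i j a ≠ 0) (by simp [hval]; omega) (by simp [hval])
    (fun hne => ?_)
    (fun h0 => Runs.skip (.inl ⟨not_not.1 h0, (h.tick _).tick _, rfl⟩)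
      (by simp only [Expr.cost]; omega)) ((by decide : 2 ≤ 30).trans hT)
  refine Runs.cond (p := target w i j a ≤ w.length) ?_ ?_ (fun hle => ?_) (fun hlt => ?_)
    (by simp only [Expr.cost]; omega)
  · simp [hval, hwidth]; omega
  · simp [hval, hwidth]
  · exact ((runs_push ((h.tick _).tick _) hne hle hval).imp fun s' hf h' =>
      .inr (.inl ⟨⟨hne, hle⟩, h', hf.out rfl⟩)).mono_time (by simp only [Expr.cost]; omega)
  · exact (runs_writeWord_follows ((h.tick _).tick _) (by omega)).mono_time
      (by simp only [Expr.cost]; omega)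

theorem runs_searchStep (h : AtNode W w pre ps j i a s) :
    Runs W (12 * w.length + 66) searchStep s (Follows W w pre ps j i a s) := by
  have hdepth_lt := h.depth_lt
  have hlen_lt := h.len_lt
  have hσ := h.alph_le
  have halph := h.alph
  have ha := a.2
  have hdepth := h.depth
  have hread : s.arr letters pre.length = a := h.letter
  refine (Runs.seq (T₁ := 5) (T₂ := 12 * w.length + 61) (P := fun s' => s'.reg Reg.letter = a)
    (Runs.assign ?_ ?_) fun s₁ hf₁ hletter₁ => ?_).mono_time (by omega)
  · simp [hdepth, hread]; omega
  · simp [hdepth, hread]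
  have h₁ : AtNode W w pre ps j i a s₁ := h.frame hf₁
  have halph₁ := h₁.alph
  refine Runs.cond (p := (a : ℕ) < σ) ?_ (by simp [hletter₁, halph₁]) (fun _ => ?_)
    (fun hσa => absurd ha hσa) (by simp only [Expr.cost]; omega)
  · simp [hletter₁, halph₁]; omega
  refine ((runs_advance (h₁.tick _) hletter₁).seq fun s₂ hf₂ h₂ => (runs_readEdge h₂
    ((hf₂.reg _ (by decide)).trans hletter₁)).seq fun s₃ hf₃ hval => (runs_followEdge
    (h₂.frame hf₃) hval).imp (Q := Follows W w pre ps j i a s) fun s' _ h' => ?_).mono_time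
      (by simp only [Expr.cost]; omega)
  have hout : s₃.out = s.out := (hf₃.out rfl).trans ((hf₂.out rfl).trans (hf₁.out rfl))
  simpa only [Follows, State.written, State.marks, hout] using h'

theorem runs_searchStep_last (h : AtNode W w pre ps j i σ s) :
    Runs W 13 searchStep s fun s' => s'.reg Reg.depth = pre.length ∧
      Frame ⟨[Reg.letter, Reg.depth], [], false⟩ s s' := by
  have hdepth_lt := h.depth_lt
  have hlen_lt := h.len_lt
  have hσ := h.alph_le
  have hdepth := h.depth
  have hread : s.arr letters pre.length = σ := h.letter
  refine Runs.seq (T₁ := 5) (T₂ := 8) (P := fun s' => s'.reg Reg.letter = σ)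
    (Runs.assign ?_ ?_) fun s₁ hf₁ hletter₁ => ?_
  · simp [hdepth, hread]; omega
  · simp [hdepth, hread]
  have h₁ : AtNode W w pre ps j i σ s₁ := h.frame hf₁
  have hdepth₁ := h₁.depth
  have halph₁ := h₁.alph
  refine Runs.cond (p := False) ?_ (by simp [hletter₁, halph₁]) False.elim fun _ =>
    (Runs.assign (Q := fun s' => s'.reg Reg.depth = pre.length) ?_ ?_).imp fun s' hf hdepth' =>
      ⟨hdepth', hf₁.append_left.trans ((Frame.tick s₁ _).trans hf.append_right)⟩
  · simp [hletter₁, halph₁]; omega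
  · simp [hdepth₁]; omega
  · simp [hdepth₁]

/-- Some rounds of the search lead from `s` to `s'`. -/
abbrev Steps (W : ℕ) : State → State → Prop := Iterates W (.reg Reg.depth) searchStep

/-- A bound for the time of a round of the search. -/
def stepTime (n : ℕ) : ℕ := 100 * (n + 1)

namespace AtNode

theorem exists_steps {Q : State → Prop} {T : ℕ} (h : AtNode W w pre ps j i b s)
    (hrun : Runs W T searchStep (s.tick 2) Q) (hT : T + 2 ≤ stepTime w.length) :
    ∃ s', Steps W s s' ∧ s'.clock ≤ s.clock + stepTime w.length ∧ Q s' := by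
  have hdepth_lt := h.depth_lt
  obtain ⟨s', hsteps, htime, hQ⟩ := hrun.exists_iterates (e := .reg Reg.depth)
    (by simp [h.depth]; omega) (by simp [h.depth])
  exact ⟨s', hsteps, htime.trans (by simp only [Expr.cost]; omega), hQ⟩

theorem exists_steps_follows (h : AtNode W w pre ps j i a s) :
    ∃ s', Steps W s s' ∧ s'.clock ≤ s.clock + stepTime w.length ∧ Follows W w pre ps j i a s s' :=
  h.exists_steps (runs_searchStep (h.tick 2)) (by unfold stepTime; omega)

theorem exists_steps_pred (h : AtNode W w pre ps j i σ s) :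
    ∃ s', Steps W s s' ∧ s'.clock ≤ s.clock + stepTime w.length ∧ s'.reg Reg.depth = pre.length ∧
      Frame ⟨[Reg.letter, Reg.depth], [], false⟩ s s' := by
  obtain ⟨s', hsteps, hclock, hdepth, hf⟩ := h.exists_steps (runs_searchStep_last (h.tick 2))
    (by unfold stepTime; omega)
  exact ⟨s', hsteps, hclock, hdepth, (Frame.tick s 2).trans hf⟩

theorem exists_steps_pop {k : ℕ} (h₀ : AtNode W w pre ps j i b s')
    (h : AtNode W w (pre ++ [a]) (ps ++ [j]) i k σ s) :
    ∃ s'', Steps W s s'' ∧ s''.clock ≤ s.clock + stepTime w.length ∧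
      AtNode W w pre ps j i (a + 1) s'' ∧ s''.out = s.out := by
  obtain ⟨s'', hsteps, htime, hdepth, hf⟩ := h.exists_steps_pred
  refine ⟨s'', hsteps, htime, ?_, hf.out rfl⟩
  exact
    { h₀ with
      toReady := h.toReady.frame hf
      depth := by simpa using hdepth
      holds_positions := by
        rw [hf.arr _ (by decide)]
        exact Holds.of_append (l' := [k]) (by simpa using h.holds_positions)
      holds_letters := by
        rw [hf.arr _ (by decide)]
        exact Holds.of_append (l' := [σ]) (by simpa [code_concat] using h.holds_letters) }

end AtNode

end Search

section Delay

variable {σ W d x y : ℕ} {w pre : List (Fin σ)} {ps : List ℕ} {i j b p : ℕ} {a : Fin σ}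
  {l l' : List ℕ} {L L' : List (List (Fin σ))} {s s' s'' : State}

/-- Some rounds of the search lead from `s` to `s'`, they write the numbers `l`, and the state `s'`
is `Late d y`. -/
structure Progress (W d y : ℕ) (l : List ℕ) (s s' : State) : Prop where
  steps : Steps W s s'
  written : s'.written = s.written ++ l
  late : Late d y s'

namespace Progress

theorem trans (h : Progress W d x l s s') (h' : Progress W d y l' s' s'') :
    Progress W d y (l ++ l') s s'' where
  steps := Relation.ReflTransGen.trans h.steps h'.steps
  written := by rw [h'.written, h.written, List.append_assoc]
  late := h'.late

theorem of_out_eq {δ : ℕ} (h : Late d x s) (hsteps : Steps W s s') (hout : s'.out = s.out)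
    (hclock : s'.clock ≤ s.clock + δ) (hxy : x + δ ≤ y) : Progress W d y [] s s' where
  steps := hsteps
  written := by rw [List.append_nil, State.written, hout, ← State.written]
  late := h.mono hout hclock hxy

end Progress

/-- The output of the search for the words `pre ++ v` with `v` in `L`. -/
def listing (pre : List (Fin σ)) (L : List (List (Fin σ))) : List ℕ :=
  L.flatMap fun v => code (pre ++ v) ++ [0]

theorem listing_append : listing pre (L ++ L') = listing pre L ++ listing pre L' :=
  List.flatMap_append

theorem listing_map_cons : listing pre (L.map (a :: ·)) = listing (pre ++ [a]) L := by
  simp [listing, List.flatMap_map]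

/-- A bound for the time that the search spends in a node, without the time in further nodes. -/
def nodeTime (n σ : ℕ) : ℕ := stepTime n * σ

/-- A bound for the delay of the search. -/
def delay (n σ : ℕ) : ℕ := 2 * (n + 1) * nodeTime n σ

open Classical in
/-- A bound for the time since the last end mark when the search is about to try the letter `a` at
the node `(i, j)`, at the end of a path of length `p`. No branch of the search is without output,
so that a node is entered after a descent of `p` nodes, which follows an ascent of at most `n + 1`.
Once an edge has been followed from this node, an ascent from depth at most `n` is all that there
is. -/
def slack (w : List (Fin σ)) (i j p a : ℕ) : ℕ :=
  (if ∃ b : Fin σ, b < a ∧ target w i j b ≠ 0 then w.length - p else w.length + 1 + p) *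
    nodeTime w.length σ + stepTime w.length * a

theorem slack_zero : slack w i j p 0 = (w.length + 1 + p) * nodeTime w.length σ := by
  simp [slack]

theorem slack_le : slack w i j p b ≤
    (w.length + 1 + p) * nodeTime w.length σ + stepTime w.length * b := by
  unfold slack; gcongr; split_ifs <;> omega

theorem slack_add_one_of_eq_zero (h : target w i j a = 0) :
    slack w i j p (a + 1) = slack w i j p a + stepTime w.length := by
  have (b : Fin σ) : b < (a : ℕ) + 1 ∧ target w i j b ≠ 0 ↔ b < (a : ℕ) ∧ target w i j b ≠ 0 := by
    refine and_congr_left fun hb => Nat.lt_succ_iff_lt_or_eq.trans (or_iff_left fun hba => hb ?_)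
    rw [Fin.ext hba, h]
  simp only [slack, this, Nat.mul_succ, add_assoc]

theorem slack_add_one_of_ne_zero (h : target w i j a ≠ 0) : slack w i j p (a + 1) =
    (w.length - p) * nodeTime w.length σ + stepTime w.length * (a + 1) := by
  rw [slack, if_pos ⟨a, Nat.lt_succ_self a, h⟩]

theorem slack_alph (hσ : 1 ≤ σ) (hp : IsPair w.length i j) (hle : p ≤ w.length) :
    slack w i j p σ = (w.length + 1 - p) * nodeTime w.length σ := by
  obtain ⟨a, ha⟩ := exists_target_ne_zero hσ hp
  rw [slack, if_pos ⟨a, a.2, ha⟩, Nat.succ_sub hle, Nat.succ_mul, nodeTime]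

/-- If the search enters the node `(i, j)`, reached along `pre`, in time, then it lists the labels
of the paths to the sink that start with `pre`, and leaves the node in time. -/
def Visits (W : ℕ) (w pre : List (Fin σ)) (ps : List ℕ) (j i : ℕ) : Prop :=
  ∀ s, AtNode W w pre ps j i 0 s →
    Late (delay w.length σ) ((w.length + 1 + pre.length) * nodeTime w.length σ) s →
    ∃ s', AtNode W w pre ps j i σ s' ∧ Progress W (delay w.length σ)
      ((w.length + 1 - pre.length) * nodeTime w.length σ) (listing pre (completions w i j)) s s'

theorem slack_add_stepTime_le :
    slack w i j p a + stepTime w.length ≤ (w.length + 1 + (p + 1)) * nodeTime w.length σ :=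
  calc slack w i j p a + stepTime w.length
      ≤ (w.length + 1 + p) * nodeTime w.length σ + stepTime w.length * (a + 1) := by
        rw [Nat.mul_succ]; have := slack_le (w := w) (i := i) (j := j) (p := p) (b := a); omega
    _ ≤ (w.length + 1 + p) * nodeTime w.length σ + stepTime w.length * σ := by
        gcongr; exact a.2
    _ = (w.length + 1 + (p + 1)) * nodeTime w.length σ := by rw [nodeTime]; ring

theorem AtNode.exists_progress_letter (h : AtNode W w pre ps j i a s)
    (hlate : Late (delay w.length σ) (slack w i j pre.length a) s)
    (hvisits : target w i j a ≠ 0 → target w i j a ≤ w.length →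
      Visits W w (pre ++ [a]) (ps ++ [j]) i (target w i j a)) :
    ∃ s', AtNode W w pre ps j i (a + 1) s' ∧ Progress W (delay w.length σ)
      (slack w i j pre.length (a + 1)) (listing pre (completionsVia w i j a)) s s' := by
  have hslack := slack_add_stepTime_le (w := w) (i := i) (j := j) (p := pre.length) (a := a)
  have hlen := h.length_le.trans h.isPair.fst_le
  obtain ⟨s₁, hsteps, hclock, ⟨h0, h₁, hout⟩ | ⟨⟨hne, hle⟩, h₁, hout⟩ | ⟨htarget, h₁, hwritten,
    hmarks⟩⟩ := h.exists_steps_follows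
  · rw [completionsVia_of_eq_zero h0]
    exact ⟨s₁, h₁, .of_out_eq hlate hsteps hout hclock (slack_add_one_of_eq_zero h0).ge⟩
  · have hlength : (pre ++ [a]).length = pre.length + 1 := by simp
    have hpush := Progress.of_out_eq hlate hsteps hout hclock hslack
    obtain ⟨s₂, h₂, hvisit⟩ := hvisits hne hle s₁ h₁ (by rw [hlength]; exact hpush.late)
    obtain ⟨s₃, hsteps₃, hclock₃, h₃, hout₃⟩ := h.exists_steps_pop h₂
    rw [completionsVia_of_le hne hle, listing_map_cons]
    refine ⟨s₃, h₃, ?_⟩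
    have hpop := Progress.of_out_eq hvisit.late hsteps₃ hout₃ hclock₃
      (y := slack w i j pre.length (a + 1)) (by
        rw [slack_add_one_of_ne_zero hne, hlength, Nat.succ_sub_succ]
        gcongr
        exact Nat.le_mul_of_pos_right _ a.succ_pos)
    simpa using hpush.trans (hvisit.trans hpop)
  · rw [completionsVia_of_eq htarget]
    refine ⟨s₁, h₁, hsteps, by simp [hwritten, listing], hlate.mark hmarks hclock ?_⟩
    exact hslack.trans (Nat.mul_le_mul_right _ (by omega))

theorem visits (hσ : 1 ≤ σ) : Visits W w pre ps j i := by
  induction hm : w.length - i using Nat.strong_induction_on generalizing pre ps j i with | _ m ih =>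
  intro s h hlate
  have hletters (b : ℕ) (hb : b ≤ σ) : ∃ s', AtNode W w pre ps j i b s' ∧
      Progress W (delay w.length σ) (slack w i j pre.length b)
        (listing pre (((List.finRange σ).take b).flatMap (completionsVia w i j))) s s' := by
    induction b with
    | zero => exact ⟨s, h, .refl, by simp [listing], slack_zero ▸ hlate⟩
    | succ b ihb =>
      obtain ⟨s₁, h₁, hprogress₁⟩ := ihb (Nat.le_of_succ_le hb)
      obtain ⟨s₂, h₂, hprogress₂⟩ := h₁.exists_progress_letter (a := ⟨b, hb⟩) hprogress₁.late
        fun hne hle => ih _ (by have := lt_target hne; omega) rfl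
      refine ⟨s₂, h₂, ?_⟩
      have hb' : b < (List.finRange σ).length := by simpa using hb
      simpa [List.take_succ_eq_append_getElem hb', listing_append] using
        hprogress₁.trans hprogress₂
  obtain ⟨s', h', hprogress⟩ := hletters σ le_rfl
  refine ⟨s', h', ?_⟩
  rw [← slack_alph hσ h.isPair (h.length_le.trans h.isPair.fst_le)]
  rwa [List.take_of_length_le (by simp), ← completions] at hprogress

theorem delay_le {n : ℕ} (hσ : σ ≤ n) : delay n σ ≤ 200 * (n + 1) ^ 3 :=
  calc 2 * (n + 1) * (100 * (n + 1) * σ) ≤ 2 * (n + 1) * (100 * (n + 1) * (n + 1)) := by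
        gcongr; omega
    _ = 200 * (n + 1) ^ 3 := by ring

theorem AtNode.exists_exec_loop (hσ : 1 ≤ σ) (h : AtNode W w [] [] 0 0 0 s) (hout : s.out = [])
    (hclock : s.clock ≤ 24) :
    ∃ s', Exec W (.loop (.reg Reg.depth) searchStep) s s' ∧
      s'.Enumerates {v | IsMAS w v} (delay w.length σ) := by
  have hstep : stepTime w.length + 2 ≤ (w.length + 1) * nodeTime w.length σ := by
    have hn := hσ.trans h.alph_le
    unfold nodeTime stepTime
    nlinarith [Nat.mul_le_mul_left ((w.length + 1) * (w.length + 1)) hσ]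
  have hlate : Late (delay w.length σ) ((w.length + 1) * nodeTime w.length σ) s :=
    ⟨by simp [State.marks, hout], by
      simpa [State.marks, hout] using hclock.trans (le_trans (by unfold stepTime; omega) hstep)⟩
  obtain ⟨s₁, h₁, hprogress⟩ := visits hσ s h hlate
  obtain ⟨s₂, hsteps, hclock₂, hdepth, hf⟩ := h₁.exists_steps_pred
  have hout₂ : s₂.out = s₁.out := hf.out rfl
  have hsearch : Steps W s s₂ := Relation.ReflTransGen.trans hprogress.steps hsteps
  refine ⟨s₂.tick 2, hsearch.exec_loop (by simp [hdepth, h.len_lt.pos]) (by simp [hdepth]),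
    ⟨completions w 0 0, nodup_completions, fun u =>
      (mem_completions_iff w.length.zero_le w.length.zero_le).trans completes_zero, ?_⟩, ?_⟩
  · have hwritten := hprogress.written
    simpa [State.written, hout, hout₂, listing] using hwritten
  · have hchain := hprogress.late.isChain_concat (t := s₂.clock + 2) (δ := stepTime w.length + 2)
      (by omega) (by simp only [delay, List.length_nil, Nat.sub_zero]; linarith)
    simpa only [State.marks, State.tick, hout₂] using hchain

theorem answers_enumerate {s₁ : State} (hσ : 1 ≤ σ) (h : Ready W w s₁) (hs : IsQueryStart s₁ s) :
    Answers W enumerate s fun s' => s'.Enumerates {v | IsMAS w v} (delay w.length σ) := by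
  obtain ⟨s₂, hexec₂, hclock, h₂⟩ := (runs_setup_of_isQueryStart h hs).seq fun s' _ h' =>
    runs_enterRoot h'
  have hout : s₂.out = [] := (hexec₂.frame.out rfl).trans hs.2.2
  obtain ⟨s₃, hexec₃, henum⟩ := h₂.exists_exec_loop hσ hout (by rw [hs.2.1] at hclock; omega)
  have hexec := Exec.seq _ _ _ _ _ hexec₂ hexec₃
  exact ⟨s₃, hexec, hexec.sameData, henum⟩

end Delay

section Bounds

variable {n c e K d d' W σ : ℕ} {S : Set (List (Fin σ))} {s : State}

theorem mul_succ_pow_le (hc : c ≤ K) (he : e ≤ K) : c * (n + 1) ^ e ≤ K * (n + 1) ^ K :=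
  Nat.mul_le_mul hc (Nat.pow_le_pow_right n.succ_pos he)

theorem succ_pow_three_lt (h : 1000 * (n + 1) ^ 1000 ≤ W) : (n + 1) ^ 3 + 10 < W := by
  have hcube : 1000 * (n + 1) ^ 3 ≤ W := (mul_succ_pow_le le_rfl (by decide)).trans h
  have hpos : 1 ≤ (n + 1) ^ 3 := Nat.pow_pos n.succ_pos
  omega

theorem Answers.mono {c : Cmd} {P Q : State → Prop} (h : Answers W c s P)
    (hPQ : ∀ s', P s' → Q s') : Answers W c s Q := by
  obtain ⟨s', hexec, hdata, hP⟩ := h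
  exact ⟨s', hexec, hdata, hPQ s' hP⟩

theorem State.Enumerates.mono (h : s.Enumerates S d) (hd : d ≤ d') : s.Enumerates S d' :=
  ⟨h.1, h.2.imp fun _ _ hle => hle.trans (Nat.add_le_add_left hd _)⟩

end Bounds

end MASRep

open MASRep in
theorem mainTheorem6 :
    ∃ (build check longest ofLength enumerate : Cmd) (K : ℕ),
      ∀ (σ : ℕ) (w : List (Fin σ)), 1 ≤ σ → σ ≤ w.length →
        -- the graph of `w` is acyclic, and its source-to-sink paths correspond to the MAS of `w`
        IsAcyclic w ∧
        Set.BijOn label {p | IsPath w (.pos 0 0) p .sink} {v | IsMAS w v} ∧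
        -- for all sufficiently large word sizes, the lower bound being of order `log n`:
        ∀ W : ℕ, K * (w.length + 1) ^ K ≤ W →
          -- construction of the graph, together with further data structures
          ∃ s₁ : State, Exec W build (initial w) s₁ ∧
            s₁.clock ≤ K * (w.length ^ 2 * σ) ∧
            s₁.arr .input = inputArray w ∧
            StoresGraph w (s₁.arr (.data 0)) ∧
            -- is a given word an MAS?
            (∀ (u : List (Fin σ)) (s : State), IsQueryStart s₁ s → u.length < W →
              s.arr .query = load (u.length :: code u) →
              Answers W check s fun s' =>
                s'.clock ≤ K * (u.length + 1) ∧ s'.Decides (IsMAS w u)) ∧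
            -- a longest MAS
            (∀ s : State, IsQueryStart s₁ s →
              Answers W longest s fun s' =>
                s'.clock ≤ K * (w.length + 1) ^ K ∧
                ∃ v, IsMAS w v ∧ (∀ v', IsMAS w v' → v'.length ≤ v.length) ∧
                  s'.written = code v) ∧
            -- is there an MAS of a given length?
            (∀ (l : ℕ) (s : State), IsQueryStart s₁ s → l < W → s.arr .query = load [l] →
              Answers W ofLength s fun s' =>
                s'.clock ≤ K * (w.length + 1) ^ K ∧
                s'.Decides (∃ v, IsMAS w v ∧ v.length = l)) ∧
            -- enumeration of all MAS
            (∀ s : State, IsQueryStart s₁ s →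
              Answers W enumerate s fun s' =>
                s'.Enumerates {v | IsMAS w v} (K * (w.length + 1) ^ K)) := by
  refine ⟨build, check, longest, ofLength, enumerate, 1000, fun σ w hσ₁ hσ =>
    ⟨isAcyclic w, bijOn_label w, fun W hK => ?_⟩⟩
  obtain ⟨s₁, hexec, hclock, h⟩ := runs_build hσ₁ hσ (succ_pow_three_lt hK)
  have htime : 300 * (w.length + 1) ^ 4 ≤ 1000 * (w.length + 1) ^ 1000 :=
    mul_succ_pow_le (by decide) (by decide)
  have hdelay : delay w.length σ ≤ 1000 * (w.length + 1) ^ 1000 :=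
    (delay_le hσ).trans (mul_succ_pow_le (by decide) (by decide))
  refine ⟨s₁, hexec, (hclock.trans_eq (Nat.zero_add _)).trans (Nat.mul_le_mul_right _ (by decide)),
    h.input, h.table.storesGraph, fun u s hs hu hq => ?_, fun s hs => ?_, fun l s hs hl hq => ?_,
    fun s hs => ?_⟩
  · exact (answers_check h hs hu hq).mono fun s' h' => ⟨h'.1.trans (by gcongr; decide), h'.2⟩
  · exact (answers_longest hσ₁ h hs).mono fun s' h' => ⟨h'.1.trans htime, h'.2⟩
  · exact (answers_ofLength h hs hl hq).mono fun s' h' => ⟨h'.1.trans htime, h'.2⟩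
  · exact (answers_enumerate hσ₁ h hs).mono fun s' h' => h'.mono hdelay
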